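/- Let $N,P\in\mathbb{N}$, let $\sigma=(\sigma_1,\dots,\sigma_P)$ with $\sigma_i\in\mathbb{R}^N$, and let $\mu$ be a nonnegative symmetric Radon measure on $\mathbb{R}^N\setminus\{0\}$ with $\int_{|z|>0}\min\{|z|^2,1\}\,d\mu(z)<\infty$. For $\psi\in C_c^\infty(\mathbb{R}^N)$ put $$\mathfrak{L}^{\sigma,\mu}[\psi](x):=\sum_{i=1}^P(\sigma_i\cdot D)^2\psi(x)+\int_{\mathbb{R}^N\setminus\{0\}}\big(\psi(x+z)-\psi(x)-z\cdot D\psi(x)\mathbf 1_{|z|\le 1}\big)\,d\mu(z).$$ Let $\varphi:\mathbb{R}\to\mathbb{R}$ be continuous and nondecreasing, and let $f\in L^\infty(\mathbb{R}^N)$. A function $w\in L^\infty(\mathbb{R}^N)$ is called a distributional solution of $$w-\mathfrak{L}^{\sigma,\mu}[\varphi(w)]=f\quad\text{on }\mathbb{R}^N$$ if $\int_{\mathbb{R}^N}\big(w\psi-\varphi(w)\,\mathfrak{L}^{\sigma,\mu}[\psi]-f\psi\big)\,dx=0$ for all $\psi\in C_c^\infty(\mathbb{R}^N)$. Theorem (Uniqueness).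 There is at most one distributional solution $w\in L^\infty(\mathbb{R}^N)$ of this equation with $w-f\in L^1(\mathbb{R}^N)$; that is, any two such solutions are equal almost everywhere. -/

import Mathlib

open MeasureTheory
open scoped ContDiff

namespace LevyDiffusion

/-- A nonnegative symmetric Radon measure `μ` on `ℝ^N \ {0}` with `∫ min (|z|², 1) dμ(z) < ∞`,
seen as a Borel measure on `ℝ^N` that does not charge the origin. (Finiteness of the integral
makes `μ` finite on every set `{r ≤ |z|}` with `r > 0`, so it is a Radon measure on `ℝ^N \ {0}`.) -/
structure IsSymmetricLevyMeasure {N : ℕ} (μ : Measure (EuclideanSpace ℝ (Fin N))) : Prop where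
  measure_zero : μ {0} = 0
  symmetric : μ.map (fun z => -z) = μ
  lintegral_lt_top : ∫⁻ z in {0}ᶜ, ENNReal.ofReal (min (‖z‖ ^ 2) 1) ∂μ < ⊤

/-- The local operator `L^σ[ψ](x) = ∑ i, ∂_{σ_i}² ψ(x) = tr (σ σᵀ D²ψ(x))`, where
`∂_{σ_i} = σ_i · D` and `σ_1, …, σ_P` are the columns of `σ`. -/
noncomputable def localOp {N P : ℕ} (σ : Fin P → EuclideanSpace ℝ (Fin N))
    (ψ : EuclideanSpace ℝ (Fin N) → ℝ) (x : EuclideanSpace ℝ (Fin N)) : ℝ :=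
  ∑ i, fderiv ℝ (fun y => fderiv ℝ ψ y (σ i)) x (σ i)

/-- The nonlocal operator
`𝓛^μ[ψ](x) = ∫_{ℝ^N \ {0}} (ψ(x+z) - ψ(x) - z · Dψ(x) 1_{|z| ≤ 1}) dμ(z)`. -/
noncomputable def levyOp {N : ℕ} (μ : Measure (EuclideanSpace ℝ (Fin N)))
    (ψ : EuclideanSpace ℝ (Fin N) → ℝ) (x : EuclideanSpace ℝ (Fin N)) : ℝ :=
  ∫ z in {0}ᶜ, (ψ (x + z) - ψ x - (if ‖z‖ ≤ 1 then fderiv ℝ ψ x z else 0)) ∂μ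

/-- The diffusion operator `𝔏^{σ,μ} = L^σ + 𝓛^μ`. -/
noncomputable def diffusionOp {N P : ℕ} (σ : Fin P → EuclideanSpace ℝ (Fin N))
    (μ : Measure (EuclideanSpace ℝ (Fin N)))
    (ψ : EuclideanSpace ℝ (Fin N) → ℝ) (x : EuclideanSpace ℝ (Fin N)) : ℝ :=
  localOp σ ψ x + levyOp μ ψ x

/-- `w ∈ L^∞(ℝ^N)` is a distributional (very weak) solution of `w - 𝔏^{σ,μ}[φ(w)] = f` on `ℝ^N`:
the operator is moved onto smooth compactly supported test functions `ψ`. -/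
structure IsDistributionalSolution {N P : ℕ} (σ : Fin P → EuclideanSpace ℝ (Fin N))
    (μ : Measure (EuclideanSpace ℝ (Fin N))) (φ : ℝ → ℝ)
    (f w : EuclideanSpace ℝ (Fin N) → ℝ) : Prop where
  memLp_top : MemLp w ⊤ volume
  weak_eq : ∀ ψ : EuclideanSpace ℝ (Fin N) → ℝ, ContDiff ℝ ∞ ψ → HasCompactSupport ψ →
    ∫ x, (w x * ψ x - φ (w x) * diffusionOp σ μ ψ x - f x * ψ x) = 0

end LevyDiffusion

set_option linter.unusedSectionVars false

/-! Let `U` be the difference of two solutions and `V` the difference of their images under `φ`.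
Then `U = 𝔏[V]` in distributions, `U` is integrable, `V` is bounded, and `∫ U V ≥ 0` by
monotonicity. Formally `∫ U V = ∫ V 𝔏[V]` is minus the energy of `V`, so the energy is zero, and
Cauchy–Schwarz for the energy form gives `∫ U g = 0` for every test function `g`.

The obstacle is that `V` is neither smooth nor integrable, so its energy need not make sense. Three
devices repair this. The operator `𝔏` is replaced by `jumpOp ν` for a finite symmetric measure `ν`,
which is bounded and self-adjoint (`exists_jumpOp_approx`). The pair `(U, V)` is mollified to `(u,
v)`, so that `jumpOp ν v` is uniformly close to `u` (`abs_jumpOp_bump_sub_le`). Finally `-v` is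
replaced by the integrable solution `h` of `ε h - jumpOp ν h = u`, whose energy is at most `-∫ u v`
plus small errors (`abs_integral_mul_le_of_jumpOp_near`).

The errors are controlled because `V` is small off sets of finite measure: `φ` is uniformly
continuous on the range of the solutions, and `U` is integrable. A Young inequality with weight `s`
replaces Cauchy–Schwarz, and `integral_mul_eq_zero` lets all parameters tend to zero. -/

namespace LevyDiffusion

/-! ### Jump operators of finite measures: resolvent, energy form, basic estimate. -/

section JumpOperators

variable {E : Type*} [NormedAddCommGroup E] [InnerProductSpace ℝ E] [FiniteDimensional ℝ E]
  [MeasurableSpace E] [BorelSpace E]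

/-- The averaging operator `g ↦ (x ↦ ∫ g(x+z) dν(z))`. -/
noncomputable def translAvg (ν : Measure E) (g : E → ℝ) (x : E) : ℝ := ∫ z, g (x + z) ∂ν

variable {ν : Measure E} [IsFiniteMeasure ν] {g k : E → ℝ}

lemma integrable_comp_add_of_bounded (hg : Measurable g) {M : ℝ} (hM : ∀ x, |g x| ≤ M) (x : E) :
    Integrable (fun z => g (x + z)) ν :=
  Integrable.of_bound (hg.comp (measurable_const_add x)).aestronglyMeasurable M
    (Filter.Eventually.of_forall fun _ => hM _)

lemma measurable_translAvg (hg : Measurable g) : Measurable (translAvg ν g) := by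
  have : StronglyMeasurable (fun p : E × E => g (p.1 + p.2)) :=
    (hg.comp (measurable_fst.add measurable_snd)).stronglyMeasurable
  exact this.integral_prod_right.measurable

lemma abs_translAvg_le {M : ℝ} (hM : ∀ x, |g x| ≤ M) (x : E) :
    |translAvg ν g x| ≤ M * ν.real Set.univ := by
  rw [← Real.norm_eq_abs]
  exact norm_integral_le_of_norm_le_const (Filter.Eventually.of_forall fun _ => hM _)

lemma integrable_comp_add_prod (hg : Integrable g) :
    Integrable (fun p : E × E => g (p.1 + p.2)) (volume.prod ν) :=
  (measurePreserving_add_prod volume ν).integrable_comp_of_integrable (hg.comp_fst ν)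

lemma integrable_translAvg (hg : Integrable g) : Integrable (translAvg ν g) :=
  (integrable_comp_add_prod hg).integral_prod_left

lemma integral_abs_translAvg_le (hg : Integrable g) :
    ∫ x, |translAvg ν g x| ≤ ν.real Set.univ * ∫ x, |g x| := by
  calc ∫ x, |translAvg ν g x| ≤ ∫ x, ∫ z, |g (x + z)| ∂ν :=
        integral_mono (integrable_translAvg hg).abs
          (integrable_comp_add_prod hg).abs.integral_prod_left
          fun x => abs_integral_le_integral_abs
    _ = ∫ z, (∫ x, |g (x + z)|) ∂ν := integral_integral_swap (integrable_comp_add_prod hg).abs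
    _ = ν.real Set.univ * ∫ x, |g x| := by
        simp_rw [integral_add_right_eq_self (fun x => |g x|)]
        simp

/-- Translating `x` by `-z` moves the shift onto `k`, and the symmetry of `ν` removes the sign.
Pairing an integrable function with a merely bounded one is essential, since `V` is only bounded. -/
lemma integral_mul_translAvg_comm (hν : ν.map (fun z => -z) = ν) (hg : Integrable g)
    (hk : Measurable k) {M : ℝ} (hM : ∀ x, |k x| ≤ M) :
    ∫ x, translAvg ν g x * k x = ∫ x, g x * translAvg ν k x := by
  have hint : Integrable (fun p : E × E => g (p.1 + p.2) * k p.1) (volume.prod ν) :=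
    (integrable_comp_add_prod hg).mul_bdd (c := M)
      (hk.comp measurable_fst).aestronglyMeasurable (Filter.Eventually.of_forall fun _ => hM _)
  have hint' : Integrable (fun p : E × E => g p.1 * k (p.1 + p.2)) (volume.prod ν) :=
    (hg.comp_fst ν).mul_bdd (c := M)
      (hk.comp (measurable_fst.add measurable_snd)).aestronglyMeasurable
      (Filter.Eventually.of_forall fun _ => hM _)
  calc ∫ x, translAvg ν g x * k x = ∫ x, ∫ z, g (x + z) * k x ∂ν := by
        simp_rw [translAvg, integral_mul_const]
    _ = ∫ z, (∫ x, g (x + z) * k x) ∂ν := integral_integral_swap hint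
    _ = ∫ z, (∫ x, g x * k (x + -z)) ∂ν := by
        congr 1 with z
        rw [← integral_add_right_eq_self (fun x => g x * k (x + -z)) z]
        simp
    _ = ∫ z, (∫ x, g x * k (x + z)) ∂ν := by
        conv_rhs => rw [← hν]
        exact ((MeasurableEquiv.neg E).measurableEmbedding.integral_map
          (μ := ν) (fun z => ∫ x, g x * k (x + z))).symm
    _ = ∫ x, ∫ z, g x * k (x + z) ∂ν := (integral_integral_swap hint').symm
    _ = ∫ x, g x * translAvg ν k x := by
        simp_rw [translAvg, integral_const_mul]

/-- Nonnegativity of the energy form: `ab ≤ (a² + b²)/2` and translation invariance of Lebesgue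
measure. -/
lemma integral_mul_translAvg_le (hg : Measurable g) (hgi : Integrable g) {M : ℝ}
    (hM : ∀ x, |g x| ≤ M) :
    ∫ x, g x * translAvg ν g x ≤ ν.real Set.univ * ∫ x, g x ^ 2 := by
  have hsq : Integrable (fun x => g x ^ 2) := by
    simpa only [sq] using hgi.mul_bdd (c := M) hg.aestronglyMeasurable
      (Filter.Eventually.of_forall hM)
  have h1 : Integrable (fun p : E × E => g p.1 ^ 2) (volume.prod ν) := hsq.comp_fst ν
  have h2 : Integrable (fun p : E × E => g (p.1 + p.2) ^ 2) (volume.prod ν) :=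
    integrable_comp_add_prod (g := fun x => g x ^ 2) hsq
  have h3 : Integrable (fun p : E × E => g p.1 * g (p.1 + p.2)) (volume.prod ν) :=
    (hgi.comp_fst ν).mul_bdd (c := M)
      (hg.comp (measurable_fst.add measurable_snd)).aestronglyMeasurable
      (Filter.Eventually.of_forall fun _ => hM _)
  have e1 : ∫ p, g p.1 ^ 2 ∂((volume : Measure E).prod ν) = ν.real Set.univ * ∫ x, g x ^ 2 := by
    rw [integral_prod _ h1]
    simp [integral_const_mul]
  have e2 : ∫ p, g (p.1 + p.2) ^ 2 ∂((volume : Measure E).prod ν)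
      = ν.real Set.univ * ∫ x, g x ^ 2 := by
    rw [integral_prod_symm _ h2]
    simp_rw [integral_add_right_eq_self (fun x => g x ^ 2)]
    simp
  have e3 : ∫ x, g x * translAvg ν g x
      = ∫ p, g p.1 * g (p.1 + p.2) ∂((volume : Measure E).prod ν) := by
    rw [integral_prod _ h3]
    simp_rw [translAvg, integral_const_mul]
  have e4 : ∫ p, g p.1 * g (p.1 + p.2) ∂((volume : Measure E).prod ν)
      ≤ ∫ p, (g p.1 ^ 2 + g (p.1 + p.2) ^ 2) / 2 ∂((volume : Measure E).prod ν) :=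
    integral_mono h3 ((h1.add h2).div_const 2) fun p => by
      dsimp only
      nlinarith [sq_nonneg (g p.1 - g (p.1 + p.2))]
  rw [integral_div, integral_add h1 h2, e1, e2] at e4
  linarith

/-- Solvability of `ε h - (ν * h - |ν| h) = u` among bounded integrable functions. -/
lemma exists_resolvent {u : E → ℝ} (hu : Measurable u) (hui : Integrable u) {C : ℝ}
    (hC : ∀ x, |u x| ≤ C) {ε : ℝ} (hε : 0 < ε) :
    ∃ h : E → ℝ, Measurable h ∧ Integrable h ∧ (∃ C', ∀ x, |h x| ≤ C') ∧
      ∀ x, (ε + ν.real Set.univ) * h x = u x + translAvg ν h x := by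
  set m := ν.real Set.univ with hm
  have hm0 : 0 ≤ m := measureReal_nonneg
  have hem : 0 < ε + m := by positivity
  set c := (ε + m)⁻¹ with hc
  have hc0 : 0 < c := inv_pos.2 hem
  have hcm0 : 0 ≤ c * m := by positivity
  have hcm : c * m < 1 := by
    rw [hc, inv_mul_lt_iff₀ hem]; linarith
  let G : ℕ → E → ℝ := fun n => (translAvg ν)^[n] u
  have hGs : ∀ n, G (n + 1) = translAvg ν (G n) := fun n => Function.iterate_succ_apply' _ _ _
  have hGm : ∀ n, Measurable (G n) := by
    intro n
    induction n with
    | zero => exact hu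
    | succ n ih => rw [hGs]; exact measurable_translAvg ih
  have hGi : ∀ n, Integrable (G n) := by
    intro n
    induction n with
    | zero => exact hui
    | succ n ih => rw [hGs]; exact integrable_translAvg ih
  have hGb : ∀ n x, |G n x| ≤ C * m ^ n := by
    intro n
    induction n with
    | zero => simpa [G] using hC
    | succ n ih =>
      rw [hGs]
      intro x
      calc _ ≤ _ := abs_translAvg_le ih x
        _ = _ := by rw [← hm]; ring
  have hGL : ∀ n, ∫ x, |G n x| ≤ m ^ n * ∫ x, |u x| := by
    intro n
    induction n with
    | zero => simp [G]
    | succ n ih =>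
      rw [hGs]
      calc _ ≤ _ := integral_abs_translAvg_le (hGi n)
        _ ≤ m * (m ^ n * ∫ x, |u x|) := by gcongr
        _ = _ := by ring
  -- Neumann series for `h = c (u + ν * h)`. It converges both uniformly and in `L¹` because
  -- averaging has norm at most `m` on each space and `c * m < 1`.
  let F : ℕ → E → ℝ := fun n x => c ^ (n + 1) * G n x
  have hFm : ∀ n, Measurable (F n) := fun n => (hGm n).const_mul _
  have hFi : ∀ n, Integrable (F n) := fun n => (hGi n).const_mul _
  have hFb : ∀ n x, ‖F n x‖ ≤ C * c * (c * m) ^ n := by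
    intro n x
    calc ‖F n x‖ = c ^ (n + 1) * |G n x| := by
          simp [F, abs_of_pos hc0]
      _ ≤ c ^ (n + 1) * (C * m ^ n) := by gcongr; exact hGb n x
      _ = _ := by ring
  have hFL : ∀ n, ∫ x, ‖F n x‖ ≤ (c * ∫ x, |u x|) * (c * m) ^ n := by
    intro n
    calc ∫ x, ‖F n x‖ = c ^ (n + 1) * ∫ x, |G n x| := by
          simp [F, abs_of_pos hc0, integral_const_mul]
      _ ≤ c ^ (n + 1) * (m ^ n * ∫ x, |u x|) := by gcongr; exact hGL n
      _ = _ := by ring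
  have hsumb : ∀ a : ℝ, Summable fun n => a * (c * m) ^ n := fun a =>
    (summable_geometric_of_lt_one hcm0 hcm).mul_left a
  have hsumF : ∀ x, Summable fun n => F n x := fun x =>
    Summable.of_norm_bounded (hsumb _) fun n => hFb n x
  have hsumL : Summable fun n => ∫ x, ‖F n x‖ :=
    Summable.of_nonneg_of_le (fun n => integral_nonneg fun _ => norm_nonneg _) hFL (hsumb _)
  let h : E → ℝ := fun x => ∑' n, F n x
  have hhm : Measurable h :=
    measurable_of_tendsto_metrizable
      (fun n => Finset.measurable_sum (Finset.range n) fun i _ => hFm i)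
      (tendsto_pi_nhds.2 fun x => by
        simpa only [Finset.sum_apply] using (hsumF x).hasSum.tendsto_sum_nat)
  have hhb : ∀ x, |h x| ≤ ∑' n, C * c * (c * m) ^ n := fun x =>
    tsum_of_norm_bounded (hsumb _).hasSum fun n => hFb n x
  have hhi : Integrable h := by
    refine ⟨hhm.aestronglyMeasurable, ?_⟩
    have hle : ∫⁻ x, ‖h x‖ₑ ≤ ∑' n, ∫⁻ x, ‖F n x‖ₑ := by
      rw [← lintegral_tsum fun n => (hFm n).enorm.aemeasurable]
      exact lintegral_mono fun x => enorm_tsum_le_tsum_enorm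
    refine lt_of_le_of_lt hle ?_
    have : ∀ n, ∫⁻ x, ‖F n x‖ₑ = ENNReal.ofReal (∫ x, ‖F n x‖) := fun n =>
      (ofReal_integral_norm_eq_lintegral_enorm (hFi n)).symm
    simp_rw [this]
    exact hsumL.tsum_ofReal_lt_top
  refine ⟨h, hhm, hhi, ⟨_, hhb⟩, fun x => ?_⟩
  have hT : HasSum (fun n => c ^ (n + 1) * G (n + 1) x) (translAvg ν h x) := by
    have := hasSum_integral_of_dominated_convergence (μ := ν)
      (F := fun n z => F n (x + z)) (f := fun z => h (x + z))
      (fun n _ => C * c * (c * m) ^ n)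
      (fun n => ((hFm n).comp (measurable_const_add x)).aestronglyMeasurable)
      (fun n => Filter.Eventually.of_forall fun z => hFb n _)
      (Filter.Eventually.of_forall fun _ => hsumb _) (integrable_const _)
      (Filter.Eventually.of_forall fun z => (hsumF _).hasSum)
    simp_rw [hGs]
    simpa only [F, translAvg, integral_const_mul] using this
  have hT2 : HasSum (fun n => (ε + m) * F (n + 1) x) (translAvg ν h x) := by
    convert hT using 2 with n
    calc (ε + m) * F (n + 1) x = (ε + m) * c * (c ^ (n + 1) * G (n + 1) x) := by
          simp only [F]; ring
      _ = _ := by rw [hc, mul_inv_cancel₀ hem.ne', one_mul]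
  have h0 : (ε + m) * F 0 x = u x := by
    simp only [F, hc, G, zero_add, pow_one, Function.iterate_zero, id, ← mul_assoc]
    rw [mul_inv_cancel₀ hem.ne', one_mul]
  -- Averaging shifts the series by one index; the missing zeroth term is `u x`.
  have h1 := (hasSum_nat_add_iff (f := fun n => (ε + m) * F n x) 1).1 hT2
  rw [Finset.sum_range_one, h0, add_comm (translAvg ν h x)] at h1
  exact ((hsumF x).hasSum.mul_left (ε + m)).unique h1

/-- The bounded nonlocal operator `g ↦ (x ↦ ∫ (g(x+z) - g(x)) dν(z))` of a finite measure. -/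
noncomputable def jumpOp (ν : Measure E) (g : E → ℝ) (x : E) : ℝ :=
  translAvg ν g x - ν.real Set.univ * g x

/-- Maximum principle: the supremum `S` satisfies `(ε + m) S ≤ R + m S`, and `m S` cancels because
`S` is finite by the a priori bound `C`, which does not enter the conclusion. -/
lemma abs_le_of_resolvent_eq {r : E → ℝ} {C R ε : ℝ} (hε : 0 < ε) (hC : ∀ x, |g x| ≤ C)
    (hr : ∀ x, |r x| ≤ R) (heq : ∀ x, (ε + ν.real Set.univ) * g x = r x + translAvg ν g x)
    (x : E) : |g x| ≤ R / ε := by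
  set m := ν.real Set.univ with hm
  have hm0 : 0 ≤ m := measureReal_nonneg
  set S := ⨆ x, |g x| with hS
  have hbdd : BddAbove (Set.range fun x => |g x|) := ⟨C, by rintro _ ⟨y, rfl⟩; exact hC y⟩
  have hgS : ∀ y, |g y| ≤ S := fun y => le_ciSup hbdd y
  have hb : ∀ y, |g y| ≤ (R + S * m) / (ε + m) := by
    intro y
    rw [le_div_iff₀ (by positivity)]
    calc |g y| * (ε + m) = |(ε + m) * g y| := by
          rw [abs_mul, abs_of_pos (by positivity : 0 < ε + m), mul_comm]
      _ = |r y + translAvg ν g y| := by rw [heq]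
      _ ≤ |r y| + |translAvg ν g y| := abs_add_le _ _
      _ ≤ R + S * m := add_le_add (hr y) (abs_translAvg_le hgS y)
  have : S ≤ (R + S * m) / (ε + m) := ciSup_le hb
  rw [le_div_iff₀ (by positivity)] at this
  refine (hgS x).trans ?_
  rw [le_div_iff₀ hε]
  linarith

lemma integral_abs_le_of_resolvent_eq {u : E → ℝ} {ε : ℝ} (hε : 0 < ε) (hg : Integrable g)
    (hu : Integrable u) (heq : ∀ x, (ε + ν.real Set.univ) * g x = u x + translAvg ν g x) :
    ε * ∫ x, |g x| ≤ ∫ x, |u x| := by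
  set m := ν.real Set.univ with hm
  have hm0 : 0 ≤ m := measureReal_nonneg
  have h1 : ∫ x, (ε + m) * |g x| ≤ ∫ x, (|u x| + |translAvg ν g x|) :=
    integral_mono (hg.abs.const_mul _) (hu.abs.add (integrable_translAvg hg).abs) fun x => by
      dsimp only
      calc (ε + m) * |g x| = |(ε + m) * g x| := by
            rw [abs_mul, abs_of_pos (by positivity : 0 < ε + m)]
        _ = |u x + translAvg ν g x| := by rw [heq]
        _ ≤ _ := abs_add_le _ _
  rw [integral_const_mul, integral_add hu.abs (integrable_translAvg hg).abs] at h1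
  have := integral_abs_translAvg_le (ν := ν) hg
  linarith

/-- The energy of `h + t g`, expanded in `t`; symmetry of `ν` merges the two cross terms. -/
lemma jumpOp_quadratic {h : E → ℝ} (hν : ν.map (fun z => -z) = ν)
    (hh : Measurable h) (hhi : Integrable h) {C : ℝ} (hC : ∀ x, |h x| ≤ C)
    (hg : Measurable g) (hgi : Integrable g) {D : ℝ} (hD : ∀ x, |g x| ≤ D) (t : ℝ) :
    0 ≤ -(∫ x, h x * jumpOp ν h x) + 2 * t * -(∫ x, h x * jumpOp ν g x)
      + t ^ 2 * -(∫ x, g x * jumpOp ν g x) := by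
  have hT : ∀ x, translAvg ν (fun x => h x + t * g x) x = translAvg ν h x + t * translAvg ν g x := by
    intro x
    simp only [translAvg]
    rw [integral_add (integrable_comp_add_of_bounded hh hC x)
      ((integrable_comp_add_of_bounded hg hD x).const_mul _), integral_const_mul]
  have key := integral_mul_translAvg_le (ν := ν) (g := fun x => h x + t * g x)
    (hh.add (hg.const_mul t)) (hhi.add (hgi.const_mul t)) (M := C + |t| * D) (fun x =>
      (abs_add_le _ _).trans (add_le_add (hC x) (by
        rw [abs_mul]; exact mul_le_mul_of_nonneg_left (hD x) (abs_nonneg _))))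
  set m := ν.real Set.univ with hm
  have mulint : ∀ {a b : E → ℝ} {B : ℝ}, Integrable a → Measurable b → (∀ x, |b x| ≤ B) →
      Integrable fun x => a x * b x := fun ha hb hB =>
    ha.mul_bdd hb.aestronglyMeasurable (Filter.Eventually.of_forall hB)
  have i1 := mulint hhi hh hC
  have i2 := mulint hhi hg hD
  have i3 := mulint hgi hg hD
  have j1 := mulint hhi (measurable_translAvg (ν := ν) hh) (abs_translAvg_le hC)
  have j2 := mulint hhi (measurable_translAvg (ν := ν) hg) (abs_translAvg_le hD)
  have j3 := mulint hgi (measurable_translAvg (ν := ν) hg) (abs_translAvg_le hD)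
  have j4 := mulint (integrable_translAvg (ν := ν) hhi) hg hD
  have hsym := integral_mul_translAvg_comm hν hhi hg hD
  have e1 : ∫ x, (h x + t * g x) * translAvg ν (fun x => h x + t * g x) x
      = ∫ x, h x * translAvg ν h x + t * (h x * translAvg ν g x)
        + t * (translAvg ν h x * g x) + t ^ 2 * (g x * translAvg ν g x) := by
    congr 1 with x
    rw [hT]; ring
  have e2 : ∫ x, (h x + t * g x) ^ 2
      = ∫ x, h x * h x + 2 * t * (h x * g x) + t ^ 2 * (g x * g x) := by
    congr 1 with x
    ring
  have k1 : Integrable fun x => h x * translAvg ν h x + t * (h x * translAvg ν g x) :=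
    j1.add (j2.const_mul _)
  have k2 : Integrable fun x => h x * translAvg ν h x + t * (h x * translAvg ν g x)
      + t * (translAvg ν h x * g x) := k1.add (j4.const_mul _)
  have k3 : Integrable fun x => h x * h x + 2 * t * (h x * g x) := i1.add (i2.const_mul _)
  rw [e1, e2, integral_add k2 (j3.const_mul _), integral_add k1 (j4.const_mul _),
    integral_add j1 (j2.const_mul _), integral_add k3 (i3.const_mul _),
    integral_add i1 (i2.const_mul _)] at key
  simp only [integral_const_mul] at key
  have f : ∀ a b : E → ℝ, Integrable (fun x => a x * translAvg ν b x) →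
      Integrable (fun x => a x * b x) →
      ∫ x, a x * jumpOp ν b x = (∫ x, a x * translAvg ν b x) - m * ∫ x, a x * b x := by
    intro a b h1 h2
    rw [← integral_const_mul, ← integral_sub h1 (h2.const_mul _)]
    congr 1 with x
    simp only [jumpOp]; ring
  rw [hsym] at key
  rw [f h h j1 i1, f h g j2 i2, f g g j3 i3]
  linarith

/-- The resolvent estimate: if `jumpOp ν v` is `ε²`-close to `u`, then `u` tested against `g` is
controlled by `-∫ u v`, up to terms that vanish with `ε` and with the part of `v` that is not
integrable. -/
lemma abs_integral_mul_le_of_jumpOp_near {u v v' : E → ℝ} {C D M ε θ s : ℝ}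
    (hν : ν.map (fun z => -z) = ν) (hε : 0 < ε) (hs : 0 < s)
    (hu : Measurable u) (hui : Integrable u) (hC : ∀ x, |u x| ≤ C)
    (hv : Measurable v) (hM : ∀ x, |v x| ≤ M) (he : ∀ x, |jumpOp ν v x - u x| ≤ ε ^ 2)
    (hv' : Integrable v') (hvv' : ∀ x, |v x - v' x| ≤ θ)
    (hg : Measurable g) (hgi : Integrable g) (hD : ∀ x, |g x| ≤ D) :
    |∫ x, u x * g x| ≤ ε * (2 * M + ε) * (∫ x, |g x|)
      + (-(∫ x, u x * v x) + ε * (2 * M + ε) * (∫ x, |v' x|) + (θ + ε) * ∫ x, |u x|) / (2 * s)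
      + s / 2 * -(∫ x, g x * jumpOp ν g x) := by
  obtain ⟨h, hh, hhi, ⟨B, hB⟩, heq⟩ := exists_resolvent (ν := ν) hu hui hC hε
  set m := ν.real Set.univ with hm
  have mulint : ∀ {a b : E → ℝ} {B : ℝ}, Integrable a → Measurable b → (∀ x, |b x| ≤ B) →
      Integrable fun x => a x * b x := fun ha hb hB =>
    ha.mul_bdd hb.aestronglyMeasurable (Filter.Eventually.of_forall hB)
  have hJm : ∀ {a : E → ℝ}, Measurable a → Measurable (jumpOp ν a) := fun ha =>
    (measurable_translAvg ha).sub (ha.const_mul _)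
  have hh2 : ∀ x, |h x| ≤ 2 * M + ε := by
    intro x
    -- The sum `h + v` solves the resolvent equation with right-hand side `ε v - (jumpOp ν v - u)`.
    -- The maximum principle divides by `ε`, which the `ε ^ 2` in the closeness hypothesis absorbs.
    have h1 : |h x + v x| ≤ (ε * M + ε ^ 2) / ε := by
      refine abs_le_of_resolvent_eq (ν := ν) (g := fun x => h x + v x)
        (r := fun x => ε * v x - (jumpOp ν v x - u x)) (C := B + M) hε
        (fun x => (abs_add_le _ _).trans (add_le_add (hB x) (hM x))) (fun x => ?_) (fun x => ?_) x
      · refine (abs_sub _ _).trans (add_le_add ?_ (he x))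
        rw [abs_mul, abs_of_pos hε]
        exact mul_le_mul_of_nonneg_left (hM x) hε.le
      · have : translAvg ν (fun x => h x + v x) x = translAvg ν h x + translAvg ν v x :=
          integral_add (integrable_comp_add_of_bounded hh hB x)
            (integrable_comp_add_of_bounded hv hM x)
        rw [this, mul_add, heq, jumpOp]
        ring
    have h2 : (ε * M + ε ^ 2) / ε = M + ε := by field_simp
    rw [h2] at h1
    have := hM x
    rw [abs_le] at *
    constructor <;> linarith
  have hL1 := integral_abs_le_of_resolvent_eq hε hhi hui heq
  -- testing the resolvent equation against a bounded function
  have test : ∀ {a : E → ℝ} {A : ℝ}, Measurable a → (∀ x, |a x| ≤ A) →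
      ∫ x, u x * a x = ε * (∫ x, h x * a x) - ∫ x, h x * jumpOp ν a x := by
    intro a A ha hA
    have hJ : ∫ x, h x * jumpOp ν a x = (∫ x, h x * translAvg ν a x) - m * ∫ x, h x * a x := by
      rw [← integral_const_mul, ← integral_sub
        (mulint hhi (measurable_translAvg ha) (abs_translAvg_le hA))
        ((mulint hhi ha hA).const_mul _)]
      congr 1 with x
      simp only [jumpOp]; ring
    have h1 : ∫ x, u x * a x = ∫ x, ((ε + m) * (h x * a x) - translAvg ν h x * a x) := by
      congr 1 with x
      rw [← mul_assoc, heq]; ring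
    rw [h1, integral_sub ((mulint hhi ha hA).const_mul _)
      (mulint (integrable_translAvg hhi) ha hA), integral_const_mul,
      integral_mul_translAvg_comm hν hhi ha hA, hJ]
    ring
  have absbound : ∀ {a b : E → ℝ} {A : ℝ}, Integrable a → (∀ x, |b x| ≤ A) →
      |∫ x, a x * b x| ≤ A * ∫ x, |a x| := by
    intro a b A ha hb
    rw [← integral_const_mul, ← Real.norm_eq_abs]
    refine norm_integral_le_of_norm_le (ha.abs.const_mul A) (Filter.Eventually.of_forall fun x => ?_)
    rw [Real.norm_eq_abs, abs_mul, mul_comm]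
    exact mul_le_mul_of_nonneg_right (hb x) (abs_nonneg _)
  have tv := test hv hM
  have th := test hh hB
  have tg := test hg hD
  have hhsq : 0 ≤ ∫ x, h x * h x := integral_nonneg fun x => mul_self_nonneg _
  -- the remainder term
  have hrem : |∫ x, h x * (jumpOp ν v x - u x)| ≤ ε * ∫ x, |u x| := by
    refine (absbound hhi he).trans ?_
    have := mul_le_mul_of_nonneg_left hL1 hε.le
    linarith
  have hsplit : ∫ x, h x * jumpOp ν v x = (∫ x, h x * (jumpOp ν v x - u x)) + ∫ x, u x * h x := by
    have i1 : Integrable fun x => h x * (jumpOp ν v x - u x) := mulint hhi ((hJm hv).sub hu) he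
    rw [← integral_add i1 (mulint hui hh hB)]
    congr 1 with x
    ring
  -- Near `v'` the uniform bound on `h` is used, on `v - v'` the `L¹` norm of `h`. The latter is
  -- only `O(1/ε)`, but this integral is later multiplied by `ε`.
  have hv'h : |∫ x, h x * v x| ≤ (2 * M + ε) * (∫ x, |v' x|) + θ * ∫ x, |h x| := by
    have i1 := mulint hv' hh hB
    have i2 : Integrable fun x => h x * v x := mulint hhi hv hM
    have : ∫ x, h x * v x = (∫ x, v' x * h x) + ∫ x, h x * (v x - v' x) := by
      rw [← integral_add i1 ((i2.sub i1).congr (Filter.Eventually.of_forall fun x => by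
        simp only [Pi.sub_apply]; ring))]
      congr 1 with x
      ring
    rw [this]
    exact (abs_add_le _ _).trans (add_le_add (absbound hv' hh2) (absbound hhi hvv'))
  -- Testing with `h` gives energy `∫ u h - ε ∫ h²`; testing with `v` gives `∫ u h = -∫ u v + ε ∫ h
  -- v - ∫ h (jumpOp ν v - u)`.
  have hR : -(∫ x, h x * jumpOp ν h x) ≤
      -(∫ x, u x * v x) + ε * (2 * M + ε) * (∫ x, |v' x|) + (θ + ε) * ∫ x, |u x| := by
    have hθ : 0 ≤ θ := (abs_nonneg _).trans (hvv' 0)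
    have a1 := mul_le_mul_of_nonneg_left ((le_abs_self _).trans hv'h) hε.le
    have a2 := mul_le_mul_of_nonneg_left hL1 hθ
    have a3 := (abs_le.1 hrem).1
    have a4 := mul_nonneg hε.le hhsq
    linarith
  have hQ : |∫ x, h x * jumpOp ν g x| ≤
      -(∫ x, h x * jumpOp ν h x) / (2 * s) + s / 2 * -(∫ x, g x * jumpOp ν g x) := by
    -- The two signs of `t` bound the cross term in absolute value.
    have q1 := jumpOp_quadratic hν hh hhi hB hg hgi hD s
    have q2 := jumpOp_quadratic hν hh hhi hB hg hgi hD (-s)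
    have e : -(∫ x, h x * jumpOp ν h x) / (2 * s) + s / 2 * -(∫ x, g x * jumpOp ν g x)
        = (-(∫ x, h x * jumpOp ν h x) + s ^ 2 * -(∫ x, g x * jumpOp ν g x)) / (2 * s) := by
      field_simp
    rw [e, le_div_iff₀ (by positivity), ← abs_of_pos (by positivity : 0 < 2 * s), ← abs_mul, abs_le]
    constructor <;> nlinarith
  have hgh : |∫ x, h x * g x| ≤ (2 * M + ε) * ∫ x, |g x| := by
    simp_rw [mul_comm (h _)]
    exact absbound hgi hh2
  rw [tg]
  calc |ε * (∫ x, h x * g x) - ∫ x, h x * jumpOp ν g x|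
      ≤ ε * |∫ x, h x * g x| + |∫ x, h x * jumpOp ν g x| := by
        refine (abs_sub _ _).trans_eq ?_
        rw [abs_mul, abs_of_pos hε]
    _ ≤ ε * ((2 * M + ε) * (∫ x, |g x|)) + (-(∫ x, h x * jumpOp ν h x) / (2 * s)
          + s / 2 * -(∫ x, g x * jumpOp ν g x)) := by gcongr
    _ ≤ _ := by
        have := div_le_div_of_nonneg_right hR (by positivity : 0 ≤ 2 * s)
        linarith

end JumpOperators

end LevyDiffusion

namespace LevyDiffusion

/-! ### Taylor estimates for test functions. -/

section Taylor

variable {F : Type*} [NormedAddCommGroup F] [NormedSpace ℝ F] {ψ : F → ℝ}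

lemma exists_taylor_bound (hψ : ContDiff ℝ 2 ψ) (hc : HasCompactSupport ψ) :
    ∃ C : ℝ, 0 ≤ C ∧ ∀ x z, |ψ (x + z) - ψ x - fderiv ℝ ψ x z| ≤ C * ‖z‖ ^ 2 := by
  obtain ⟨C, hC⟩ := ContDiff.lipschitzWith_of_hasCompactSupport (hc.fderiv (𝕜 := ℝ))
    (hψ.fderiv_right (m := 1) (by norm_num)) one_ne_zero
  refine ⟨C, C.2, fun x z => ?_⟩
  have := (convex_closedBall x ‖z‖).norm_image_sub_le_of_norm_fderiv_le' (𝕜 := ℝ) (f := ψ)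
    (φ := fderiv ℝ ψ x) (C := C * ‖z‖) (x := x) (y := x + z)
    (fun y _ => (hψ.differentiable (by norm_num)).differentiableAt)
    (fun y hy => (hC.norm_sub_le y x).trans (by
      gcongr
      simpa [dist_eq_norm] using hy))
    (by simp) (by simp)
  simp only [add_sub_cancel_left, Real.norm_eq_abs] at this
  linarith

lemma contDiff_fderiv_apply (hψ : ContDiff ℝ ∞ ψ) (v : F) :
    ContDiff ℝ ∞ fun y => fderiv ℝ ψ y v :=
  (hψ.fderiv_right (m := ∞) (by simp)).clm_apply contDiff_const

lemma tsupport_fderiv_apply_subset (v : F) :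
    tsupport (fun y => fderiv ℝ ψ y v) ⊆ tsupport ψ := by
  refine closure_minimal (fun y hy => ?_) (isClosed_tsupport ψ)
  refine support_fderiv_subset ℝ fun h => hy ?_
  simp [h]

lemma fderiv_eq_zero_of_notMem_tsupport {x : F} (hx : x ∉ tsupport ψ) : fderiv ℝ ψ x = 0 := by
  by_contra h
  exact hx (support_fderiv_subset ℝ h)

/-- Mean value inequality on `[0, r]` for the second difference minus `t² c`, where `c` is the
second derivative. Its derivative in `t` is `O(t²)`, by the Taylor bound applied to the directional
derivative at `x ± t v`; this gives `O(r³)` before division by `r²`. -/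
lemma exists_second_difference_bound (hψ : ContDiff ℝ ∞ ψ) (hc : HasCompactSupport ψ) (v : F) :
    ∃ C : ℝ, 0 ≤ C ∧ ∀ x (r : ℝ), 0 < r →
      |(r⁻¹) ^ 2 * ((ψ (x + r • v) - ψ x) + (ψ (x + -(r • v)) - ψ x))
        - fderiv ℝ (fun y => fderiv ℝ ψ y v) x v| ≤ C * r := by
  have hG := contDiff_fderiv_apply hψ v
  have hGc : HasCompactSupport fun y => fderiv ℝ ψ y v :=
    hc.of_isClosed_subset (isClosed_tsupport _) (tsupport_fderiv_apply_subset v)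
  obtain ⟨C, hC0, hC⟩ := exists_taylor_bound (contDiff_infty.1 hG 2) hGc
  set G := fun y => fderiv ℝ ψ y v with hGdef
  refine ⟨2 * C * ‖v‖ ^ 2, by positivity, fun x r hr => ?_⟩
  set c := fderiv ℝ G x v with hcdef
  have hder : ∀ t : ℝ, HasDerivAt (fun t : ℝ => (ψ (x + t • v) - ψ x) + (ψ (x + -(t • v)) - ψ x)
      - t ^ 2 * c) (G (x + t • v) - G (x + -(t • v)) - 2 * t * c) t := by
    intro t
    have hl : HasDerivAt (fun t : ℝ => x + t • v) v t := by
      simpa using ((hasDerivAt_id t).smul_const v).const_add x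
    have hl' : HasDerivAt (fun t : ℝ => x + -(t • v)) (-v) t := by
      simpa using ((hasDerivAt_id t).smul_const v).neg.const_add x
    have hd : ∀ y, HasFDerivAt ψ (fderiv ℝ ψ y) y := fun y =>
      (hψ.differentiable (by simp) y).hasFDerivAt
    have h1 := ((hd _).comp_hasDerivAt t hl).sub_const (ψ x)
    have h2 := ((hd _).comp_hasDerivAt t hl').sub_const (ψ x)
    have h3 : HasDerivAt (fun t : ℝ => t ^ 2 * c) (2 * t * c) t := by
      simpa using (hasDerivAt_pow 2 t).mul_const c
    have h4 := (h1.add h2).sub h3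
    rw [map_neg, ← sub_eq_add_neg] at h4
    exact h4
  have hbd : ∀ t ∈ Set.Ico (0 : ℝ) r,
      ‖G (x + t • v) - G (x + -(t • v)) - 2 * t * c‖ ≤ 2 * C * ‖v‖ ^ 2 * r ^ 2 := by
    intro t ht
    have h1 := hC x (t • v)
    have h2 := hC x (-(t • v))
    simp only [map_neg, map_smul, smul_eq_mul, norm_neg, norm_smul, ← hcdef] at h1 h2
    rw [Real.norm_eq_abs]
    calc _ = |(G (x + t • v) - G x - t * c) - (G (x + -(t • v)) - G x - -(t * c))| := by
          congr 1; ring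
      _ ≤ _ := abs_sub _ _
      _ ≤ 2 * C * ‖v‖ ^ 2 * t ^ 2 := by
          refine (add_le_add h1 h2).trans_eq ?_
          rw [mul_pow, Real.norm_eq_abs, sq_abs]; ring
      _ ≤ _ := by
          have := ht.1
          have := ht.2.le
          gcongr
  have key := norm_image_sub_le_of_norm_deriv_le_segment' (a := (0 : ℝ)) (b := r)
    (fun t _ => (hder t).hasDerivWithinAt) hbd r ⟨hr.le, le_rfl⟩
  simp only [zero_smul, neg_zero, add_zero, sub_self, Real.norm_eq_abs, sub_zero, ne_eq,
    OfNat.ofNat_ne_zero, not_false_eq_true, zero_pow, zero_mul] at key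
  have e : (r⁻¹) ^ 2 * ((ψ (x + r • v) - ψ x) + (ψ (x + -(r • v)) - ψ x)) - c
      = (r⁻¹) ^ 2 * ((ψ (x + r • v) - ψ x) + (ψ (x + -(r • v)) - ψ x) - r ^ 2 * c) := by
    field_simp
  rw [e, abs_mul, abs_of_pos (by positivity)]
  calc _ ≤ (r⁻¹) ^ 2 * (2 * C * ‖v‖ ^ 2 * r ^ 2 * r) := by gcongr
    _ = _ := by field_simp

end Taylor

/-! ### Approximation of the diffusion operator by finite symmetric measures. -/

section Levy

variable {N P : ℕ} {μ : Measure (EuclideanSpace ℝ (Fin N))}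

lemma IsSymmetricLevyMeasure.integrable_min (hμ : IsSymmetricLevyMeasure μ) :
    Integrable (fun z => min (‖z‖ ^ 2) 1) (μ.restrict {0}ᶜ) := by
  have hm : Measurable fun z : EuclideanSpace ℝ (Fin N) => min (‖z‖ ^ 2) (1 : ℝ) :=
    (measurable_norm.pow_const 2).min measurable_const
  refine ⟨hm.aestronglyMeasurable, ?_⟩
  show HasFiniteIntegral _ _
  rw [hasFiniteIntegral_iff_ofReal (Filter.Eventually.of_forall fun z => by positivity)]
  exact hμ.lintegral_lt_top

lemma IsSymmetricLevyMeasure.measure_lt_top (hμ : IsSymmetricLevyMeasure μ) {r : ℝ} (hr : 0 < r) :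
    μ {z | r < ‖z‖} < ⊤ := by
  have h := hμ.integrable_min.measure_norm_ge_lt_top
    (show 0 < min (r ^ 2) 1 by positivity)
  have hms : MeasurableSet {z : EuclideanSpace ℝ (Fin N) | min (r ^ 2) 1 ≤ ‖min (‖z‖ ^ 2) (1 : ℝ)‖} :=
    measurableSet_le measurable_const ((measurable_norm.pow_const 2).min measurable_const).norm
  rw [Measure.restrict_apply hms] at h
  refine lt_of_le_of_lt (measure_mono ?_) h
  intro z hz
  refine ⟨?_, ?_⟩
  · simp only [Set.mem_ofPred_eq] at hz ⊢
    rw [Real.norm_of_nonneg (by positivity)]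
    gcongr
  · rintro rfl
    simp at hz
    linarith

lemma measurableSet_lt_norm (r : ℝ) :
    MeasurableSet {z : EuclideanSpace ℝ (Fin N) | r < ‖z‖} :=
  measurableSet_lt measurable_const measurable_norm

lemma norm_le_of_mem_compl {r : ℝ} {z : EuclideanSpace ℝ (Fin N)}
    (hz : z ∈ {z : EuclideanSpace ℝ (Fin N) | r < ‖z‖}ᶜ) : ‖z‖ ≤ r := by
  simpa using hz

lemma map_neg_restrict (hμ : μ.map (fun z => -z) = μ) (r : ℝ) :
    (μ.restrict {z | r < ‖z‖}).map (fun z => -z) = μ.restrict {z | r < ‖z‖} := by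
  have := Measure.restrict_map (μ := μ) measurable_neg (measurableSet_lt_norm (N := N) r)
  rw [show (Neg.neg : EuclideanSpace ℝ (Fin N) → _) = fun z => -z from rfl, hμ] at this
  simpa using this.symm

/-- A finite symmetric measure whose jump operator approximates `diffusionOp σ μ` as `r → 0`. -/
noncomputable def approxMeasure (σ : Fin P → EuclideanSpace ℝ (Fin N))
    (μ : Measure (EuclideanSpace ℝ (Fin N))) (r : ℝ) : Measure (EuclideanSpace ℝ (Fin N)) :=
  μ.restrict {z | r < ‖z‖} +
    ∑ i, ENNReal.ofReal (r⁻¹ ^ 2) • (Measure.dirac (r • σ i) + Measure.dirac (-(r • σ i)))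

lemma isFiniteMeasure_approxMeasure (hμ : IsSymmetricLevyMeasure μ)
    (σ : Fin P → EuclideanSpace ℝ (Fin N)) {r : ℝ} (hr : 0 < r) :
    IsFiniteMeasure (approxMeasure σ μ r) := by
  refine ⟨?_⟩
  simp only [approxMeasure, Measure.add_apply, Measure.coe_finsetSum, Finset.sum_apply,
    Measure.smul_apply, Measure.restrict_apply_univ, measure_univ]
  refine ENNReal.add_lt_top.2 ⟨hμ.measure_lt_top hr, ENNReal.sum_lt_top.2 fun i _ => ?_⟩
  exact ENNReal.mul_lt_top ENNReal.ofReal_lt_top (by simp)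

lemma map_neg_approxMeasure (hμ : IsSymmetricLevyMeasure μ)
    (σ : Fin P → EuclideanSpace ℝ (Fin N)) (r : ℝ) :
    (approxMeasure σ μ r).map (fun z => -z) = approxMeasure σ μ r := by
  have hneg : Measurable fun z : EuclideanSpace ℝ (Fin N) => -z := measurable_neg
  rw [approxMeasure, Measure.map_add _ _ hneg, map_neg_restrict hμ.symmetric]
  congr 1
  rw [← Measure.mapₗ_apply_of_measurable hneg, map_sum]
  refine Finset.sum_congr rfl fun i _ => ?_
  rw [Measure.mapₗ_apply_of_measurable hneg, Measure.map_smul, Measure.map_add _ _ hneg,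
    Measure.map_dirac' hneg, Measure.map_dirac' hneg, neg_neg, add_comm]

lemma jumpOp_eq_integral {ν : Measure (EuclideanSpace ℝ (Fin N))} [IsFiniteMeasure ν]
    {g : EuclideanSpace ℝ (Fin N) → ℝ} (hg : Measurable g) {M : ℝ} (hM : ∀ x, |g x| ≤ M)
    (x : EuclideanSpace ℝ (Fin N)) : jumpOp ν g x = ∫ z, (g (x + z) - g x) ∂ν := by
  rw [integral_sub (integrable_comp_add_of_bounded hg hM x) (integrable_const _), jumpOp, translAvg]
  simp

lemma jumpOp_approxMeasure (hμ : IsSymmetricLevyMeasure μ)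
    (σ : Fin P → EuclideanSpace ℝ (Fin N)) {r : ℝ} (hr : 0 < r)
    {g : EuclideanSpace ℝ (Fin N) → ℝ} (hg : Measurable g) {M : ℝ} (hM : ∀ x, |g x| ≤ M)
    (x : EuclideanSpace ℝ (Fin N)) :
    jumpOp (approxMeasure σ μ r) g x = (∫ z in {z | r < ‖z‖}, (g (x + z) - g x) ∂μ)
      + ∑ i, r⁻¹ ^ 2 * ((g (x + r • σ i) - g x) + (g (x + -(r • σ i)) - g x)) := by
  have := isFiniteMeasure_approxMeasure hμ σ hr
  have hint : Integrable (fun z => g (x + z) - g x) (approxMeasure σ μ r) :=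
    (integrable_comp_add_of_bounded hg hM x).sub (integrable_const _)
  have hm : Measurable fun z => g (x + z) - g x :=
    (hg.comp (measurable_const_add x)).sub_const _
  rw [jumpOp_eq_integral hg hM]
  rw [approxMeasure] at hint ⊢
  have hint2 := integrable_finsetSum_measure.1 hint.right_of_add_measure
  rw [integral_add_measure hint.left_of_add_measure hint.right_of_add_measure,
    integral_finsetSum_measure hint2]
  congr 1
  refine Finset.sum_congr rfl fun i _ => ?_
  rw [integral_smul_measure, integral_add_measure, integral_dirac, integral_dirac,
    ENNReal.toReal_ofReal (by positivity), smul_eq_mul]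
  · exact integrable_dirac (by simp)
  · exact integrable_dirac (by simp)

lemma IsSymmetricLevyMeasure.restrict_compl (hμ : IsSymmetricLevyMeasure μ) :
    μ.restrict {0}ᶜ = μ :=
  Measure.restrict_eq_self_of_ae_mem (measure_eq_zero_iff_ae_notMem.1 hμ.measure_zero)

lemma IsSymmetricLevyMeasure.integrable_min' (hμ : IsSymmetricLevyMeasure μ) :
    Integrable (fun z => min (‖z‖ ^ 2) 1) μ := by
  simpa only [hμ.restrict_compl] using hμ.integrable_min

/-- The balls decrease into `{0}`, which `μ` does not charge. -/
lemma IsSymmetricLevyMeasure.tendsto_setIntegral_min (hμ : IsSymmetricLevyMeasure μ) {r : ℕ → ℝ}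
    (hr : Antitone r) (hr0 : Filter.Tendsto r Filter.atTop (nhds 0)) :
    Filter.Tendsto (fun n => ∫ z in {z | r n < ‖z‖}ᶜ, min (‖z‖ ^ 2) 1 ∂μ) Filter.atTop (nhds 0) := by
  have h := tendsto_setIntegral_of_antitone (μ := μ) (f := fun z => min (‖z‖ ^ 2) (1 : ℝ))
    (s := fun n => {z | r n < ‖z‖}ᶜ) (fun n => (measurableSet_lt_norm (r n)).compl)
    (fun m n hmn z hz => by
      simp only [Set.mem_compl_iff, Set.mem_ofPred_eq, not_lt] at hz ⊢
      exact hz.trans (hr hmn))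
    ⟨0, hμ.integrable_min'.integrableOn⟩
  convert h using 2
  refine (setIntegral_measure_zero _ (measure_mono_null (fun z hz => ?_) hμ.measure_zero)).symm
  have : ‖z‖ ≤ 0 := ge_of_tendsto' hr0 fun n => by
    simpa using Set.mem_iInter.1 hz n
  simpa using this

variable {ψ : EuclideanSpace ℝ (Fin N) → ℝ}

lemma exists_abs_le_of_hasCompactSupport (hψ : Continuous ψ) (hc : HasCompactSupport ψ) :
    ∃ M, ∀ x, |ψ x| ≤ M := hc.exists_bound_of_continuous hψ

/-- On the large jumps the gradient term is odd in `z`, so it integrates to zero against the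
symmetric `μ`. On the small ones `r ≤ 1` makes the cutoff equal to one. -/
lemma levyOp_eq_add (hμ : IsSymmetricLevyMeasure μ) (hψ : ContDiff ℝ ∞ ψ)
    (hc : HasCompactSupport ψ) {r : ℝ} (hr : 0 < r) (hr1 : r ≤ 1) (x : EuclideanSpace ℝ (Fin N)) :
    levyOp μ ψ x = (∫ z in {z | r < ‖z‖}, (ψ (x + z) - ψ x) ∂μ)
      + ∫ z in {z | r < ‖z‖}ᶜ, (ψ (x + z) - ψ x - fderiv ℝ ψ x z) ∂μ := by
  obtain ⟨C, hC0, hC⟩ := exists_taylor_bound (contDiff_infty.1 hψ 2) hc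
  obtain ⟨M, hM⟩ := exists_abs_le_of_hasCompactSupport hψ.continuous hc
  have hM0 : 0 ≤ M := (abs_nonneg _).trans (hM 0)
  have hms := measurableSet_lt_norm (N := N) r
  have hD : Measurable fun z : EuclideanSpace ℝ (Fin N) => if ‖z‖ ≤ 1 then fderiv ℝ ψ x z else 0 :=
    Measurable.ite (measurableSet_le measurable_norm measurable_const)
      (fderiv ℝ ψ x).continuous.measurable measurable_const
  have hT : Measurable fun z => ψ (x + z) - ψ x :=
    (hψ.continuous.measurable.comp (measurable_const_add x)).sub_const _
  have hint : Integrable (fun z => ψ (x + z) - ψ x - (if ‖z‖ ≤ 1 then fderiv ℝ ψ x z else 0)) μ := by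
    refine (hμ.integrable_min'.const_mul (C + 2 * M)).mono' (hT.sub hD).aestronglyMeasurable
      (Filter.Eventually.of_forall fun z => ?_)
    rw [Real.norm_eq_abs]
    split_ifs with hz
    · rw [min_eq_left (by nlinarith [norm_nonneg z])]
      refine (hC x z).trans ?_
      gcongr
      linarith
    · have : 1 < ‖z‖ := not_le.1 hz
      rw [min_eq_right (by nlinarith), sub_zero, mul_one]
      have h1 := (abs_sub (ψ (x + z)) (ψ x)).trans (add_le_add (hM _) (hM _))
      linarith
  rw [levyOp, hμ.restrict_compl, ← integral_add_compl hms hint]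
  congr 1
  · have hfin : IsFiniteMeasure (μ.restrict {z : EuclideanSpace ℝ (Fin N) | r < ‖z‖}) :=
      ⟨by rw [Measure.restrict_apply_univ]; exact hμ.measure_lt_top hr⟩
    have hTi : IntegrableOn (fun z => ψ (x + z) - ψ x) {z | r < ‖z‖} μ :=
      (integrable_comp_add_of_bounded hψ.continuous.measurable hM x).sub (integrable_const _)
    have hDi : IntegrableOn (fun z => if ‖z‖ ≤ 1 then fderiv ℝ ψ x z else 0) {z | r < ‖z‖} μ :=
      (hTi.sub hint.integrableOn).congr (Filter.Eventually.of_forall fun z => by simp)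
    rw [integral_sub hTi hDi]
    have hodd : ∫ z in {z | r < ‖z‖}, (if ‖z‖ ≤ 1 then fderiv ℝ ψ x z else 0) ∂μ
        = -∫ z in {z | r < ‖z‖}, (if ‖z‖ ≤ 1 then fderiv ℝ ψ x z else 0) ∂μ := by
      conv_lhs => rw [← map_neg_restrict hμ.symmetric r]
      rw [← integral_neg]
      refine ((MeasurableEquiv.neg _).measurableEmbedding.integral_map _).trans ?_
      refine integral_congr_ae (Filter.Eventually.of_forall fun z => ?_)
      simp only [MeasurableEquiv.neg_apply, norm_neg, map_neg]
      split_ifs <;> simp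
    have h0 : ∫ z in {z | r < ‖z‖}, (if ‖z‖ ≤ 1 then fderiv ℝ ψ x z else 0) ∂μ = 0 := by linarith
    rw [h0, sub_zero]
  · refine setIntegral_congr_fun hms.compl fun z hz => ?_
    have : ‖z‖ ≤ 1 := (norm_le_of_mem_compl hz).trans hr1
    simp [this]

/-- The operator `diffusionOp σ μ` is the limit of bounded jump operators, uniformly and with
uniformly bounded supports of the differences. -/
lemma exists_jumpOp_approx (hμ : IsSymmetricLevyMeasure μ) (σ : Fin P → EuclideanSpace ℝ (Fin N)) :
    ∃ ν : ℕ → Measure (EuclideanSpace ℝ (Fin N)), (∀ n, IsFiniteMeasure (ν n)) ∧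
      (∀ n, (ν n).map (fun z => -z) = ν n) ∧
      ∀ ψ : EuclideanSpace ℝ (Fin N) → ℝ, ContDiff ℝ ∞ ψ → HasCompactSupport ψ →
        ∃ K, IsCompact K ∧ ∀ η > 0, ∀ᶠ n in Filter.atTop, ∀ x,
          |jumpOp (ν n) ψ x - diffusionOp σ μ ψ x| ≤ η ∧
          (x ∉ K → jumpOp (ν n) ψ x = diffusionOp σ μ ψ x) := by
  let r : ℕ → ℝ := fun n => 1 / ((n : ℝ) + 1)
  have hr : ∀ n, 0 < r n := fun n => by positivity
  have hanti : Antitone r := fun m n hmn => one_div_le_one_div_of_le (by positivity) (by gcongr)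
  have hr1 : ∀ n, r n ≤ 1 := fun n => by simpa [r] using hanti (Nat.zero_le n)
  have hr0 : Filter.Tendsto r Filter.atTop (nhds 0) := tendsto_one_div_add_atTop_nhds_zero_nat
  refine ⟨fun n => approxMeasure σ μ (r n), fun n => isFiniteMeasure_approxMeasure hμ σ (hr n),
    fun n => map_neg_approxMeasure hμ σ _, fun ψ hψ hc => ?_⟩
  obtain ⟨C, hC0, hC⟩ := exists_taylor_bound (contDiff_infty.1 hψ 2) hc
  obtain ⟨M, hM⟩ := exists_abs_le_of_hasCompactSupport hψ.continuous hc
  choose S hS0 hS using fun i => exists_second_difference_bound hψ hc (σ i)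
  -- Both operators treat jumps longer than `r n` identically. What differs involves only
  -- displacements of length at most one once `r n • σ i` is that short, so it vanishes at distance
  -- more than one from the support.
  refine ⟨Metric.cthickening 1 (tsupport ψ), IsCompact.cthickening hc, fun η hη => ?_⟩
  have hdiff : ∀ n x, jumpOp (approxMeasure σ μ (r n)) ψ x - diffusionOp σ μ ψ x
      = (∑ i, ((r n)⁻¹ ^ 2 * ((ψ (x + r n • σ i) - ψ x) + (ψ (x + -(r n • σ i)) - ψ x))
          - fderiv ℝ (fun y => fderiv ℝ ψ y (σ i)) x (σ i)))
        - ∫ z in {z | r n < ‖z‖}ᶜ, (ψ (x + z) - ψ x - fderiv ℝ ψ x z) ∂μ := by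
    intro n x
    rw [jumpOp_approxMeasure hμ σ (hr n) hψ.continuous.measurable hM, diffusionOp, localOp,
      levyOp_eq_add hμ hψ hc (hr n) (hr1 n), Finset.sum_sub_distrib]
    ring
  have hbound : ∀ n x, |jumpOp (approxMeasure σ μ (r n)) ψ x - diffusionOp σ μ ψ x|
      ≤ (∑ i, S i) * r n + C * ∫ z in {z | r n < ‖z‖}ᶜ, min (‖z‖ ^ 2) 1 ∂μ := by
    intro n x
    rw [hdiff]
    refine (abs_sub _ _).trans (add_le_add ?_ ?_)
    · rw [Finset.sum_mul]
      exact (Finset.abs_sum_le_sum_abs _ _).trans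
        (Finset.sum_le_sum fun i _ => hS i x (r n) (hr n))
    · rw [← integral_const_mul, ← Real.norm_eq_abs]
      refine norm_integral_le_of_norm_le (hμ.integrable_min'.integrableOn.const_mul C) ?_
      filter_upwards [ae_restrict_mem (measurableSet_lt_norm (r n)).compl] with z hz
      have : ‖z‖ ≤ 1 := (norm_le_of_mem_compl hz).trans (hr1 n)
      rw [min_eq_left (by nlinarith [norm_nonneg z])]
      exact hC x z
  have hlim : Filter.Tendsto (fun n => (∑ i, S i) * r n
      + C * ∫ z in {z | r n < ‖z‖}ᶜ, min (‖z‖ ^ 2) 1 ∂μ) Filter.atTop (nhds 0) := by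
    simpa using (hr0.const_mul (∑ i, S i)).add ((hμ.tendsto_setIntegral_min hanti hr0).const_mul C)
  have hsmall : ∀ᶠ n in Filter.atTop, ∀ i, ‖r n • σ i‖ ≤ 1 := by
    rw [Filter.eventually_all]
    intro i
    have : Filter.Tendsto (fun n => ‖r n • σ i‖) Filter.atTop (nhds 0) := by
      simpa using (hr0.smul_const (σ i)).norm
    exact this.eventually_le_const one_pos
  filter_upwards [hlim.eventually_le_const hη, hsmall] with n hn hσ x
  refine ⟨(hbound n x).trans hn, fun hx => ?_⟩
  have hnot : ∀ z : EuclideanSpace ℝ (Fin N), ‖z‖ ≤ 1 → x + z ∉ tsupport ψ := fun z hz h =>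
    hx (Metric.mem_cthickening_of_dist_le x (x + z) 1 _ h (by simpa [dist_eq_norm] using hz))
  have hxs : x ∉ tsupport ψ := by simpa using hnot 0 (by simp)
  have hz0 : ∀ z : EuclideanSpace ℝ (Fin N), ‖z‖ ≤ 1 → ψ (x + z) = 0 := fun z hz =>
    image_eq_zero_of_notMem_tsupport (hnot z hz)
  have hx0 : ψ x = 0 := image_eq_zero_of_notMem_tsupport hxs
  rw [← sub_eq_zero, hdiff, Finset.sum_eq_zero fun i _ => ?_, zero_sub, neg_eq_zero]
  · refine setIntegral_eq_zero_of_forall_eq_zero fun z hz => ?_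
    rw [hz0 z ((norm_le_of_mem_compl hz).trans (hr1 n)), hx0, fderiv_eq_zero_of_notMem_tsupport hxs]
    simp
  · rw [hz0 _ (hσ i), hz0 _ (by rw [norm_neg]; exact hσ i), hx0,
      fderiv_eq_zero_of_notMem_tsupport fun h => hxs (tsupport_fderiv_apply_subset _ h)]
    simp

end Levy

end LevyDiffusion

namespace LevyDiffusion

/-! ### Mollification as averaging against a probability measure. -/

section Mollification

variable {E : Type*} [NormedAddCommGroup E] [InnerProductSpace ℝ E] [FiniteDimensional ℝ E]
  [MeasurableSpace E] [BorelSpace E] {U : E → ℝ}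

/-- Continuity of translations in `L¹`, read off from the continuous action `DomAddAct` on `Lp`. -/
lemma exists_integral_abs_translate_sub_le (hU : Integrable U) {η : ℝ} (hη : 0 < η) :
    ∃ δ > 0, ∀ z : E, ‖z‖ < δ → ∫ x, |U (x + z) - U x| ≤ η := by
  have hUp : MemLp U 1 (volume : Measure E) := memLp_one_iff_integrable.2 hU
  have : Fact ((1 : ENNReal) ≠ ⊤) := ⟨ENNReal.one_ne_top⟩
  have hcont : Continuous fun z : E => ‖(DomAddAct.mk z +ᵥ hUp.toLp U) - hUp.toLp U‖ := by
    have h1 : Continuous fun z : E => DomAddAct.mk z +ᵥ hUp.toLp U :=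
      DomAddAct.continuous_mk.vadd continuous_const
    exact (h1.sub continuous_const).norm
  have heq : ∀ z : E, ‖(DomAddAct.mk z +ᵥ hUp.toLp U) - hUp.toLp U‖ = ∫ x, |U (x + z) - U x| := by
    intro z
    rw [DomAddAct.mk_vadd_toLp, ← MemLp.toLp_sub, L1.norm_eq_integral_norm]
    refine integral_congr_ae ?_
    filter_upwards [MemLp.coeFn_toLp ((hUp.comp_measurePreserving
      (measurePreserving_vadd z volume)).sub hUp)] with x hx
    refine (congrArg norm hx).trans ?_
    simp [add_comm]
  have h0 : ∫ x, |U (x + 0) - U x| = 0 := by simp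
  have hev : ∀ᶠ z in nhds (0 : E), ∫ x, |U (x + z) - U x| < η := by
    simp_rw [heq] at hcont
    exact hcont.continuousAt.eventually_lt_const (by simpa using hη)
  obtain ⟨δ, hδ, h⟩ := Metric.eventually_nhds_iff.1 hev
  exact ⟨δ, hδ, fun z hz => (h (by simpa using hz)).le⟩

lemma integral_abs_translAvg_sub_le {κ : Measure E} [IsProbabilityMeasure κ] (hU : Integrable U)
    {η : ℝ} (h : ∀ᵐ z ∂κ, ∫ x, |U (x + z) - U x| ≤ η) :
    ∫ x, |translAvg κ U x - U x| ≤ η := by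
  have hi : Integrable (fun p : E × E => U (p.1 + p.2) - U p.1) (volume.prod κ) :=
    (integrable_comp_add_prod hU).sub (hU.comp_fst κ)
  have hae : ∀ᵐ x, translAvg κ U x - U x = ∫ z, (U (x + z) - U x) ∂κ := by
    filter_upwards [(integrable_comp_add_prod (ν := κ) hU).prod_right_ae] with x hx
    rw [integral_sub hx (integrable_const _), translAvg]
    simp
  calc ∫ x, |translAvg κ U x - U x| ≤ ∫ x, ∫ z, |U (x + z) - U x| ∂κ := by
        refine integral_mono_ae ((integrable_translAvg hU).sub hU).abs hi.abs.integral_prod_left ?_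
        filter_upwards [hae] with x hx
        rw [hx]
        exact abs_integral_le_integral_abs
    _ = ∫ z, (∫ x, |U (x + z) - U x|) ∂κ := integral_integral_swap hi.abs
    _ ≤ ∫ _, η ∂κ := integral_mono_ae hi.abs.integral_prod_right (integrable_const _) h
    _ = η := by simp

lemma translAvg_comm {ν κ : Measure E} [IsFiniteMeasure ν] [IsFiniteMeasure κ] (hU : Measurable U)
    {M : ℝ} (hM : ∀ x, |U x| ≤ M) (x : E) :
    translAvg ν (translAvg κ U) x = translAvg κ (translAvg ν U) x := by
  simp only [translAvg]
  rw [integral_integral_swap (f := fun z y => U (x + z + y))]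
  · simp_rw [add_right_comm]
  · exact Integrable.of_bound (hU.comp ((measurable_fst.const_add x).add
      measurable_snd)).aestronglyMeasurable M (Filter.Eventually.of_forall fun _ => hM _)

/-- The probability measure whose density is a normalized bump function. -/
noncomputable def bumpMeasure (ρ : ContDiffBump (0 : E)) : Measure E :=
  volume.withDensity fun z => ENNReal.ofReal (ρ.normed volume z)

instance isProbabilityMeasure_bumpMeasure (ρ : ContDiffBump (0 : E)) :
    IsProbabilityMeasure (bumpMeasure ρ) := by
  refine ⟨?_⟩
  rw [bumpMeasure, withDensity_apply _ MeasurableSet.univ, Measure.restrict_univ,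
    ← ofReal_integral_eq_lintegral_ofReal ρ.integrable_normed
      (Filter.Eventually.of_forall ρ.nonneg_normed), ρ.integral_normed, ENNReal.ofReal_one]

lemma map_neg_bumpMeasure (ρ : ContDiffBump (0 : E)) :
    (bumpMeasure ρ).map (fun z => -z) = bumpMeasure ρ := by
  ext s hs
  have hneg : Measurable fun z : E => -z := measurable_neg
  rw [Measure.map_apply hneg hs, bumpMeasure, withDensity_apply _ (hneg hs), withDensity_apply _ hs,
    ← (Measure.measurePreserving_neg (volume : Measure E)).setLIntegral_comp_preimage hs
      ρ.continuous_normed.measurable.ennreal_ofReal]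
  simp_rw [ρ.normed_neg]

lemma ae_bumpMeasure_norm_lt (ρ : ContDiffBump (0 : E)) : ∀ᵐ z ∂bumpMeasure ρ, ‖z‖ < ρ.rOut := by
  rw [bumpMeasure, ae_withDensity_iff ρ.continuous_normed.measurable.ennreal_ofReal]
  refine Filter.Eventually.of_forall fun z hz => ?_
  have : z ∈ Function.support (ρ.normed volume) := fun h => hz (by simp [h])
  rw [ρ.support_normed_eq] at this
  simpa using this

/-- Writes the mollification at `x` as a pairing with a translated bump, an admissible test function
in the distributional equation. -/
lemma translAvg_bumpMeasure (ρ : ContDiffBump (0 : E)) (U : E → ℝ) (x : E) :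
    translAvg (bumpMeasure ρ) U x = ∫ y, U y * ρ.normed volume (y - x) := by
  rw [translAvg, bumpMeasure, integral_withDensity_eq_integral_toReal_smul
    ρ.continuous_normed.measurable.ennreal_ofReal
      (Filter.Eventually.of_forall fun _ => ENNReal.ofReal_lt_top),
    ← integral_sub_right_eq_self _ x]
  congr 1 with y
  rw [ENNReal.toReal_ofReal (ρ.nonneg_normed _), smul_eq_mul, mul_comm, add_sub_cancel]

lemma exists_bumpMeasure_near (hU : Integrable U) {η : ℝ} (hη : 0 < η) :
    ∃ ρ : ContDiffBump (0 : E), ∫ x, |translAvg (bumpMeasure ρ) U x - U x| ≤ η := by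
  obtain ⟨δ, hδ, h⟩ := exists_integral_abs_translate_sub_le hU hη
  refine ⟨⟨δ / 2, δ, by positivity, by linarith⟩, integral_abs_translAvg_sub_le hU ?_⟩
  filter_upwards [ae_bumpMeasure_norm_lt _] with z hz
  exact h z hz

end Mollification

/-! ### Energy inequality for the mollified pair and passage to the limit. -/

section Uniqueness

variable {N P : ℕ} {μ : Measure (EuclideanSpace ℝ (Fin N))} {σ : Fin P → EuclideanSpace ℝ (Fin N)}
  {ψ : EuclideanSpace ℝ (Fin N) → ℝ}

lemma tendsto_jumpOp {ν : ℕ → Measure (EuclideanSpace ℝ (Fin N))}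
    (h : ∃ K, IsCompact K ∧ ∀ η > 0, ∀ᶠ n in Filter.atTop, ∀ x,
      |jumpOp (ν n) ψ x - diffusionOp σ μ ψ x| ≤ η ∧
      (x ∉ K → jumpOp (ν n) ψ x = diffusionOp σ μ ψ x)) (x : EuclideanSpace ℝ (Fin N)) :
    Filter.Tendsto (fun n => jumpOp (ν n) ψ x) Filter.atTop (nhds (diffusionOp σ μ ψ x)) := by
  obtain ⟨K, -, h⟩ := h
  rw [Metric.tendsto_nhds]
  intro η hη
  filter_upwards [h (η / 2) (half_pos hη)] with n hn
  rw [Real.dist_eq]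
  exact (hn x).1.trans_lt (half_lt_self hη)

lemma measurable_jumpOp {E : Type*} [NormedAddCommGroup E] [InnerProductSpace ℝ E]
    [FiniteDimensional ℝ E] [MeasurableSpace E] [BorelSpace E] {ν : Measure E} [IsFiniteMeasure ν]
    {g : E → ℝ} (hg : Measurable g) : Measurable (jumpOp ν g) :=
  (measurable_translAvg hg).sub (hg.const_mul _)

lemma integrable_jumpOp {E : Type*} [NormedAddCommGroup E] [InnerProductSpace ℝ E]
    [FiniteDimensional ℝ E] [MeasurableSpace E] [BorelSpace E] {ν : Measure E} [IsFiniteMeasure ν]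
    {g : E → ℝ} (hg : Integrable g) : Integrable (jumpOp ν g) :=
  (integrable_translAvg hg).sub (hg.const_mul _)

lemma measurable_diffusionOp (hμ : IsSymmetricLevyMeasure μ) (hψ : ContDiff ℝ ∞ ψ)
    (hc : HasCompactSupport ψ) : Measurable (diffusionOp σ μ ψ) := by
  obtain ⟨ν, hfin, -, h⟩ := exists_jumpOp_approx hμ σ
  exact measurable_of_tendsto_metrizable (fun n => measurable_jumpOp hψ.continuous.measurable)
    (tendsto_pi_nhds.2 fun x => tendsto_jumpOp (h ψ hψ hc) x)

/-- Translation invariance is immediate for jump operators and passes to the pointwise limit. -/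
lemma diffusionOp_comp_sub (hμ : IsSymmetricLevyMeasure μ) (hψ : ContDiff ℝ ∞ ψ)
    (hc : HasCompactSupport ψ) (x y : EuclideanSpace ℝ (Fin N)) :
    diffusionOp σ μ (fun y => ψ (y - x)) y = diffusionOp σ μ ψ (y - x) := by
  obtain ⟨ν, hfin, -, h⟩ := exists_jumpOp_approx hμ σ
  have h1 := tendsto_jumpOp (h (fun y => ψ (y - x)) (hψ.comp (contDiff_id.sub contDiff_const))
    (hc.comp_homeomorph (Homeomorph.subRight x))) y
  refine tendsto_nhds_unique h1 ((tendsto_jumpOp (h ψ hψ hc) (y - x)).congr fun n => ?_)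
  simp only [jumpOp, translAvg, sub_add_eq_add_sub]

/-- `L¹` form of the approximation of `diffusionOp σ μ`. -/
lemma eventually_integral_jumpOp_sub_le (hμ : IsSymmetricLevyMeasure μ)
    {ν : ℕ → Measure (EuclideanSpace ℝ (Fin N))} (hfin : ∀ n, IsFiniteMeasure (ν n))
    (hψ : ContDiff ℝ ∞ ψ) (hc : HasCompactSupport ψ)
    (h : ∃ K, IsCompact K ∧ ∀ η > 0, ∀ᶠ n in Filter.atTop, ∀ x,
      |jumpOp (ν n) ψ x - diffusionOp σ μ ψ x| ≤ η ∧
      (x ∉ K → jumpOp (ν n) ψ x = diffusionOp σ μ ψ x)) {η : ℝ} (hη : 0 < η) :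
    ∀ᶠ n in Filter.atTop, Integrable (fun x => jumpOp (ν n) ψ x - diffusionOp σ μ ψ x) ∧
      ∫ x, |jumpOp (ν n) ψ x - diffusionOp σ μ ψ x| ≤ η := by
  obtain ⟨K, hK, h⟩ := h
  have hKm := hK.measurableSet
  have hpos : 0 < η / (volume.real K + 1) := by positivity
  filter_upwards [h _ hpos] with n hn
  have hle : ∀ x, ‖jumpOp (ν n) ψ x - diffusionOp σ μ ψ x‖
      ≤ K.indicator (fun _ => η / (volume.real K + 1)) x := by
    intro x
    by_cases hx : x ∈ K
    · rw [Set.indicator_of_mem hx]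
      exact (hn x).1
    · rw [Set.indicator_of_notMem hx, (hn x).2 hx, sub_self, norm_zero]
  have hi : Integrable (K.indicator fun _ => η / (volume.real K + 1))
      (volume : Measure (EuclideanSpace ℝ (Fin N))) :=
    (integrable_indicator_iff hKm).2 (integrableOn_const hK.measure_lt_top.ne)
  have hint : Integrable fun x => jumpOp (ν n) ψ x - diffusionOp σ μ ψ x :=
    hi.mono' ((measurable_jumpOp hψ.continuous.measurable).sub
      (measurable_diffusionOp hμ hψ hc)).aestronglyMeasurable (Filter.Eventually.of_forall hle)
  refine ⟨hint, (integral_mono hint.abs hi hle).trans ?_⟩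
  rw [integral_indicator hKm, setIntegral_const, smul_eq_mul, mul_div_assoc', div_le_iff₀ (by positivity)]
  nlinarith

lemma integrable_diffusionOp (hμ : IsSymmetricLevyMeasure μ) (hψ : ContDiff ℝ ∞ ψ)
    (hc : HasCompactSupport ψ) : Integrable (diffusionOp σ μ ψ) := by
  obtain ⟨ν, hfin, -, h⟩ := exists_jumpOp_approx hμ σ
  obtain ⟨n, hn, -⟩ := (eventually_integral_jumpOp_sub_le hμ hfin hψ hc (h ψ hψ hc) one_pos).exists
  have := (integrable_jumpOp (ν := ν n) (hψ.continuous.integrable_of_hasCompactSupport hc)).sub hn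
  exact this.congr (Filter.Eventually.of_forall fun x => by simp)

lemma abs_integral_mul_le_of_abs_le {E : Type*} [MeasurableSpace E] {m : Measure E} {a b : E → ℝ}
    {A : ℝ} (ha : Integrable a m) (hb : ∀ x, |b x| ≤ A) :
    |∫ x, a x * b x ∂m| ≤ A * ∫ x, |a x| ∂m := by
  rw [← integral_const_mul, ← Real.norm_eq_abs]
  refine norm_integral_le_of_norm_le (ha.abs.const_mul A) (Filter.Eventually.of_forall fun x => ?_)
  rw [Real.norm_eq_abs, abs_mul, mul_comm]
  exact mul_le_mul_of_nonneg_right (hb x) (abs_nonneg _)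

lemma Integrable.mul_of_abs_le {E : Type*} [MeasurableSpace E] {m : Measure E} {a b : E → ℝ}
    {A : ℝ} (ha : Integrable a m) (hb : Measurable b) (hA : ∀ x, |b x| ≤ A) :
    Integrable (fun x => a x * b x) m :=
  ha.mul_bdd hb.aestronglyMeasurable (Filter.Eventually.of_forall hA)

lemma le_of_forall_pos_le_continuous {a : ℝ} {F : ℝ → ℝ} (hF : Continuous F)
    (h : ∀ t > 0, a ≤ F t) : a ≤ F 0 :=
  ge_of_tendsto ((hF.tendsto 0).mono_left (nhdsWithin_le_nhds (s := Set.Ioi 0)))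
    (Filter.eventually_of_mem self_mem_nhdsWithin h)

variable {U V : EuclideanSpace ℝ (Fin N) → ℝ} {M : ℝ}

/-- After mollification, `jumpOp ν` maps `V` to a uniform approximation of `U`. -/
lemma abs_jumpOp_bump_sub_le (hμ : IsSymmetricLevyMeasure μ)
    {ν : Measure (EuclideanSpace ℝ (Fin N))} [IsFiniteMeasure ν] (hν : ν.map (fun z => -z) = ν)
    (hV : Measurable V) (hM : ∀ x, |V x| ≤ M)
    (hUV : ∀ ψ : EuclideanSpace ℝ (Fin N) → ℝ, ContDiff ℝ ∞ ψ → HasCompactSupport ψ →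
      ∫ x, U x * ψ x = ∫ x, V x * diffusionOp σ μ ψ x)
    (ρ : ContDiffBump (0 : EuclideanSpace ℝ (Fin N)))
    (x : EuclideanSpace ℝ (Fin N)) :
    |jumpOp ν (translAvg (bumpMeasure ρ) V) x - translAvg (bumpMeasure ρ) U x|
      ≤ M * ∫ y, |jumpOp ν (ρ.normed volume) y - diffusionOp σ μ (ρ.normed volume) y| := by
  set r := ρ.normed (volume : Measure (EuclideanSpace ℝ (Fin N))) with hr
  have hrs : ContDiff ℝ ∞ r := ρ.contDiff_normed
  have hrc : HasCompactSupport r := ρ.hasCompactSupport_normed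
  have hri : Integrable r := ρ.integrable_normed
  have hTV := abs_translAvg_le (ν := ν) hM
  have hu : translAvg (bumpMeasure ρ) U x = ∫ y, diffusionOp σ μ r (y - x) * V y := by
    rw [translAvg_bumpMeasure, hUV (fun y => r (y - x)) (hrs.comp (contDiff_id.sub contDiff_const))
      (hrc.comp_homeomorph (Homeomorph.subRight x))]
    congr 1 with y
    rw [diffusionOp_comp_sub hμ hrs hrc, mul_comm]
  have hv1 : translAvg ν (translAvg (bumpMeasure ρ) V) x
      = ∫ y, translAvg ν r (y - x) * V y := by
    rw [translAvg_comm hV hM, translAvg_bumpMeasure]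
    have := integral_mul_translAvg_comm hν (hri.comp_sub_right x) hV hM
    simp_rw [mul_comm (translAvg ν V _)]
    rw [← this]
    congr 1 with y
    simp only [translAvg, sub_add_eq_add_sub]
  have hi1 : Integrable fun y => translAvg ν r (y - x) * V y :=
    Integrable.mul_of_abs_le ((integrable_translAvg hri).comp_sub_right x) hV hM
  have hi2 : Integrable fun y => r (y - x) * V y :=
    Integrable.mul_of_abs_le (hri.comp_sub_right x) hV hM
  have hi3 : Integrable fun y => diffusionOp σ μ r (y - x) * V y :=
    Integrable.mul_of_abs_le ((integrable_diffusionOp hμ hrs hrc).comp_sub_right x) hV hM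
  have hj : jumpOp ν (translAvg (bumpMeasure ρ) V) x - translAvg (bumpMeasure ρ) U x
      = ∫ y, (jumpOp ν r (y - x) - diffusionOp σ μ r (y - x)) * V y := by
    have hi4 : Integrable fun y => translAvg ν r (y - x) * V y
        - ν.real Set.univ * (r (y - x) * V y) := hi1.sub (hi2.const_mul _)
    have hexp : ∀ y, (jumpOp ν r (y - x) - diffusionOp σ μ r (y - x)) * V y
        = translAvg ν r (y - x) * V y - ν.real Set.univ * (r (y - x) * V y)
          - diffusionOp σ μ r (y - x) * V y := fun y => by
      simp only [jumpOp]; ring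
    simp_rw [hexp]
    rw [integral_sub hi4 hi3, integral_sub hi1 (hi2.const_mul _), integral_const_mul, ← hu, ← hv1,
      jumpOp, translAvg_bumpMeasure ρ V]
    simp_rw [mul_comm (V _), hr]
  rw [hj]
  refine (abs_integral_mul_le_of_abs_le ?_ hM).trans_eq ?_
  · exact ((integrable_jumpOp hri).sub (integrable_diffusionOp hμ hrs hrc)).comp_sub_right x
  · rw [integral_sub_right_eq_self (fun y => |jumpOp ν r y - diffusionOp σ μ r y|) x]

/-- The resolvent argument: a mollified pair `(U, V)` satisfies the energy-type inequality. -/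
lemma abs_integral_bump_mul_le (hμ : IsSymmetricLevyMeasure μ) (hU : Measurable U)
    (hUi : Integrable U) (hV : Measurable V) (hM : ∀ x, |V x| ≤ M)
    (hfinV : ∀ θ > 0, volume {x | θ ≤ |V x|} < ⊤)
    (hUV : ∀ ψ : EuclideanSpace ℝ (Fin N) → ℝ, ContDiff ℝ ∞ ψ → HasCompactSupport ψ →
      ∫ x, U x * ψ x = ∫ x, V x * diffusionOp σ μ ψ x)
    {g : EuclideanSpace ℝ (Fin N) → ℝ} (hg : ContDiff ℝ ∞ g) (hgc : HasCompactSupport g) {D : ℝ}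
    (hD : ∀ x, |g x| ≤ D) (ρ : ContDiffBump (0 : EuclideanSpace ℝ (Fin N))) {s : ℝ} (hs : 0 < s) :
    |∫ x, translAvg (bumpMeasure ρ) U x * g x|
      ≤ -(∫ x, translAvg (bumpMeasure ρ) U x * translAvg (bumpMeasure ρ) V x) / (2 * s)
        + s / 2 * (D * ((∫ x, |diffusionOp σ μ g x|) + 1)) := by
  obtain ⟨ν, hfin, hsym, hconv⟩ := exists_jumpOp_approx hμ σ
  set κ := bumpMeasure ρ with hκ
  set r := ρ.normed (volume : Measure (EuclideanSpace ℝ (Fin N))) with hr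
  have hrs : ContDiff ℝ ∞ r := ρ.contDiff_normed
  have hrc : HasCompactSupport r := ρ.hasCompactSupport_normed
  obtain ⟨B, hB⟩ := exists_abs_le_of_hasCompactSupport hrs.continuous hrc
  have hM0 : 0 ≤ M := (abs_nonneg _).trans (hM 0)
  have hD0 : 0 ≤ D := (abs_nonneg _).trans (hD 0)
  have hgi : Integrable g := hg.continuous.integrable_of_hasCompactSupport hgc
  -- The bound comes from the sup norm of the kernel and the `L¹` norm of `U`.
  have hub : ∀ x, |translAvg κ U x| ≤ B * ∫ x, |U x| := fun x => by
    rw [hκ, translAvg_bumpMeasure]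
    exact abs_integral_mul_le_of_abs_le hUi fun y => hB _
  have hvb : ∀ x, |translAvg κ V x| ≤ M := fun x => by
    simpa using abs_translAvg_le (ν := κ) hM x
  have hL := integral_abs_translAvg_le (ν := κ) hUi
  rw [probReal_univ, one_mul] at hL
  have hεθ : ∀ θ > 0, ∀ ε > 0, |∫ x, translAvg κ U x * g x|
      ≤ ε * (2 * M + ε) * (∫ x, |g x|)
        + (-(∫ x, translAvg κ U x * translAvg κ V x)
          + ε * (2 * M + ε) * (∫ x, |translAvg κ ({x | θ ≤ |V x|}.indicator V) x|)
          + (θ + ε) * ∫ x, |U x|) / (2 * s)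
        + s / 2 * (D * ((∫ x, |diffusionOp σ μ g x|) + 1)) := by
    intro θ hθ ε hε
    have hset : MeasurableSet {x | θ ≤ |V x|} := measurableSet_le measurable_const hV.norm
    have hV' : Integrable ({x | θ ≤ |V x|}.indicator V) := by
      rw [integrable_indicator_iff hset]
      exact Measure.integrableOn_of_bounded (hfinV θ hθ).ne hV.aestronglyMeasurable
        (Filter.Eventually.of_forall hM)
    have hV'm : Measurable ({x | θ ≤ |V x|}.indicator V) := hV.indicator hset
    have hV'b : ∀ x, |{x | θ ≤ |V x|}.indicator V x| ≤ M := fun x => by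
      by_cases hx : x ∈ {x | θ ≤ |V x|}
      · rw [Set.indicator_of_mem hx]; exact hM x
      · rw [Set.indicator_of_notMem hx, abs_zero]; exact hM0
    have hVV' : ∀ x, |translAvg κ V x - translAvg κ ({x | θ ≤ |V x|}.indicator V) x| ≤ θ := by
      intro x
      have : translAvg κ V x - translAvg κ ({x | θ ≤ |V x|}.indicator V) x
          = translAvg κ (fun y => V y - {x | θ ≤ |V x|}.indicator V y) x :=
        (integral_sub (integrable_comp_add_of_bounded hV hM x)
          (integrable_comp_add_of_bounded hV'm hV'b x)).symm
      rw [this]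
      have hb : ∀ y, |V y - {x | θ ≤ |V x|}.indicator V y| ≤ θ := fun y => by
        by_cases hy : y ∈ {x | θ ≤ |V x|}
        · rw [Set.indicator_of_mem hy, sub_self, abs_zero]; exact hθ.le
        · rw [Set.indicator_of_notMem hy, sub_zero]
          exact (not_le.1 (by simpa using hy)).le
      simpa using abs_translAvg_le (ν := κ) hb x
    -- The first condition yields the `ε ^ 2` closeness; the second bounds the energy of `g`
    -- independently of `n`, hence of `ε`.
    obtain ⟨n, ⟨hn1i, hn1⟩, ⟨hn2i, hn2⟩⟩ := ((eventually_integral_jumpOp_sub_le hμ hfin hrs hrc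
      (hconv r hrs hrc) (show 0 < ε ^ 2 / (M + 1) by positivity)).and
      (eventually_integral_jumpOp_sub_le hμ hfin hg hgc (hconv g hg hgc) one_pos)).exists
    have := hfin n
    have he : ∀ x, |jumpOp (ν n) (translAvg κ V) x - translAvg κ U x| ≤ ε ^ 2 := by
      intro x
      refine (abs_jumpOp_bump_sub_le hμ (hsym n) hV hM hUV ρ x).trans ?_
      refine (mul_le_mul_of_nonneg_left hn1 hM0).trans ?_
      rw [mul_div_assoc', div_le_iff₀ (by positivity)]
      nlinarith [sq_nonneg ε]
    have key := abs_integral_mul_le_of_jumpOp_near (ν := ν n) (hsym n) hε hs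
      (measurable_translAvg hU) (integrable_translAvg (ν := κ) hUi) hub (measurable_translAvg hV)
      hvb he (integrable_translAvg hV') hVV' hg.continuous.measurable hgi hD
    refine key.trans ?_
    have hQ : -(∫ x, g x * jumpOp (ν n) g x) ≤ D * ((∫ x, |diffusionOp σ μ g x|) + 1) := by
      have hji := integrable_jumpOp (ν := ν n) hgi
      have hLi := integrable_diffusionOp (σ := σ) hμ hg hgc
      calc -(∫ x, g x * jumpOp (ν n) g x) ≤ |∫ x, jumpOp (ν n) g x * g x| := by
            simp_rw [mul_comm (g _)]
            exact neg_le_abs _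
        _ ≤ D * ∫ x, |jumpOp (ν n) g x| := abs_integral_mul_le_of_abs_le hji hD
        _ ≤ D * ((∫ x, |diffusionOp σ μ g x|) + 1) := by
            gcongr
            have hsum : Integrable fun x => |diffusionOp σ μ g x|
                + |jumpOp (ν n) g x - diffusionOp σ μ g x| := hLi.abs.add hn2i.abs
            refine (integral_mono hji.abs hsum fun x => ?_).trans ?_
            · have := abs_add_le (diffusionOp σ μ g x) (jumpOp (ν n) g x - diffusionOp σ μ g x)
              simpa using this
            · rw [integral_add hLi.abs hn2i.abs]
              gcongr
    gcongr
  -- `ε` tends to zero with `θ` fixed, since the `L¹` norm of the truncation of `V` has no bound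
  -- uniform in `θ`.
  have hθ : ∀ θ > 0, |∫ x, translAvg κ U x * g x|
      ≤ (-(∫ x, translAvg κ U x * translAvg κ V x) + θ * ∫ x, |U x|) / (2 * s)
        + s / 2 * (D * ((∫ x, |diffusionOp σ μ g x|) + 1)) := by
    intro θ hθ
    simpa using le_of_forall_pos_le_continuous
      (F := fun ε => ε * (2 * M + ε) * (∫ x, |g x|)
        + (-(∫ x, translAvg κ U x * translAvg κ V x)
          + ε * (2 * M + ε) * (∫ x, |translAvg κ ({x | θ ≤ |V x|}.indicator V) x|)
          + (θ + ε) * ∫ x, |U x|) / (2 * s)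
        + s / 2 * (D * ((∫ x, |diffusionOp σ μ g x|) + 1)))
      (by fun_prop) fun ε hε => hεθ θ hθ ε hε
  simpa using le_of_forall_pos_le_continuous
    (F := fun θ => (-(∫ x, translAvg κ U x * translAvg κ V x) + θ * ∫ x, |U x|) / (2 * s)
        + s / 2 * (D * ((∫ x, |diffusionOp σ μ g x|) + 1)))
    (by fun_prop) fun θ h => hθ θ h

/-- If `U = 𝔏[V]` in the sense of distributions with `U` integrable, `V` bounded and small off sets
of finite measure, and `∫ U V ≥ 0`, then `U = 0` as a distribution. -/
lemma integral_mul_eq_zero (hμ : IsSymmetricLevyMeasure μ) (hU : Measurable U)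
    (hUi : Integrable U) (hV : Measurable V) (hM : ∀ x, |V x| ≤ M)
    (hfinV : ∀ θ > 0, volume {x | θ ≤ |V x|} < ⊤) (hpos : 0 ≤ ∫ x, U x * V x)
    (hUV : ∀ ψ : EuclideanSpace ℝ (Fin N) → ℝ, ContDiff ℝ ∞ ψ → HasCompactSupport ψ →
      ∫ x, U x * ψ x = ∫ x, V x * diffusionOp σ μ ψ x)
    {g : EuclideanSpace ℝ (Fin N) → ℝ} (hg : ContDiff ℝ ∞ g) (hgc : HasCompactSupport g) :
    ∫ x, U x * g x = 0 := by
  obtain ⟨D, hD⟩ := exists_abs_le_of_hasCompactSupport hg.continuous hgc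
  have hM0 : 0 ≤ M := (abs_nonneg _).trans (hM 0)
  have hD0 : 0 ≤ D := (abs_nonneg _).trans (hD 0)
  set Q := D * ((∫ x, |diffusionOp σ μ g x|) + 1) with hQ
  have hsη : ∀ s > 0, ∀ η > 0, |∫ x, U x * g x| ≤ D * η + (2 * M * η) / (2 * s) + s / 2 * Q := by
    intro s hs η hη
    obtain ⟨ρ, hρ⟩ := exists_bumpMeasure_near hUi hη
    have key := abs_integral_bump_mul_le hμ hU hUi hV hM hfinV hUV hg hgc hD ρ hs
    set κ := bumpMeasure ρ with hκ
    have hui := integrable_translAvg (ν := κ) hUi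
    have hvb : ∀ x, |translAvg κ V x| ≤ M := fun x => by
      simpa using abs_translAvg_le (ν := κ) hM x
    have hdi : Integrable fun x => translAvg κ U x - U x := hui.sub hUi
    have h1 : ∫ x, U x * g x
        = (∫ x, translAvg κ U x * g x) - ∫ x, (translAvg κ U x - U x) * g x := by
      rw [← integral_sub (Integrable.mul_of_abs_le hui hg.continuous.measurable hD)
        (Integrable.mul_of_abs_le hdi hg.continuous.measurable hD)]
      congr 1 with x
      ring
    have hcomm := integral_mul_translAvg_comm (map_neg_bumpMeasure ρ) hUi hV hM
    -- Self-adjointness of the mollifier puts every error on `translAvg κ U - U`, small in `L¹`; no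
    -- convergence of the mollified `V` is needed.
    have h2 : ∫ x, translAvg κ U x * translAvg κ V x = (∫ x, U x * V x)
        + (∫ x, (translAvg κ U x - U x) * translAvg κ V x)
        + ∫ x, (translAvg κ U x - U x) * V x := by
      have e1 : ∫ x, (translAvg κ U x - U x) * translAvg κ V x
          = (∫ x, translAvg κ U x * translAvg κ V x) - ∫ x, U x * translAvg κ V x := by
        rw [← integral_sub (Integrable.mul_of_abs_le hui (measurable_translAvg hV) hvb)
          (Integrable.mul_of_abs_le hUi (measurable_translAvg hV) hvb)]
        simp_rw [sub_mul]
      have e2 : ∫ x, (translAvg κ U x - U x) * V x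
          = (∫ x, translAvg κ U x * V x) - ∫ x, U x * V x := by
        rw [← integral_sub (Integrable.mul_of_abs_le hui hV hM)
          (Integrable.mul_of_abs_le hUi hV hM)]
        simp_rw [sub_mul]
      linarith
    have b1 := (abs_integral_mul_le_of_abs_le hdi hD).trans (mul_le_mul_of_nonneg_left hρ hD0)
    have b2 := (abs_le.1 ((abs_integral_mul_le_of_abs_le hdi hvb).trans
      (mul_le_mul_of_nonneg_left hρ hM0))).1
    have b3 := (abs_le.1 ((abs_integral_mul_le_of_abs_le hdi hM).trans
      (mul_le_mul_of_nonneg_left hρ hM0))).1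
    have b4 : -(∫ x, translAvg κ U x * translAvg κ V x) / (2 * s) ≤ (2 * M * η) / (2 * s) := by
      gcongr
      linarith
    rw [h1]
    refine (abs_sub _ _).trans ?_
    linarith
  -- The mollification error carries a factor `1 / s`, so `η` tends to zero before `s`.
  have hs : ∀ s > 0, |∫ x, U x * g x| ≤ s / 2 * Q := by
    intro s hs
    simpa using le_of_forall_pos_le_continuous
      (F := fun η => D * η + (2 * M * η) / (2 * s) + s / 2 * Q)
      (by fun_prop) fun η hη => hsη s hs η hη
  have h0 : |∫ x, U x * g x| ≤ 0 := by
    simpa using le_of_forall_pos_le_continuous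
      (F := fun s => s / 2 * Q)
      (by fun_prop) fun s h => hs s h
  exact abs_eq_zero.1 (le_antisymm h0 (abs_nonneg _))

/-- A measurable representative is clipped at the essential supremum, so that later bounds hold
everywhere. -/
lemma exists_measurable_bounded_of_memLp_top {E : Type*} [MeasurableSpace E] {m : Measure E}
    {w : E → ℝ} (hw : MemLp w ⊤ m) :
    ∃ w' : E → ℝ, ∃ B, Measurable w' ∧ (∀ x, |w' x| ≤ B) ∧ w =ᵐ[m] w' := by
  set B := (eLpNorm w ⊤ m).toReal with hB
  have hB0 : 0 ≤ B := ENNReal.toReal_nonneg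
  obtain ⟨v, hv, hwv⟩ := hw.1.aemeasurable
  refine ⟨fun x => max (-B) (min B (v x)), B, measurable_const.max (measurable_const.min hv),
    fun x => abs_le.2 ⟨le_max_left _ _, max_le (by linarith) (min_le_left _ _)⟩, ?_⟩
  have hb : ∀ᵐ x ∂m, |w x| ≤ B := by
    filter_upwards [ae_le_eLpNormEssSup (f := w) (μ := m)] with x hx
    rw [← eLpNorm_exponent_top] at hx
    simpa only [toReal_enorm, Real.norm_eq_abs] using ENNReal.toReal_mono hw.2.ne hx
  filter_upwards [hwv, hb] with x hx hbx
  rw [← hx, min_eq_right (abs_le.1 hbx).2, max_eq_right (abs_le.1 hbx).1]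

end Uniqueness

end LevyDiffusion

/-! ### The difference of two solutions. -/

theorem mainTheorem3 {N P : ℕ} (σ : Fin P → EuclideanSpace ℝ (Fin N))
    (μ : Measure (EuclideanSpace ℝ (Fin N))) (hμ : LevyDiffusion.IsSymmetricLevyMeasure μ)
    (φ : ℝ → ℝ) (hφ_cont : Continuous φ) (hφ_mono : Monotone φ)
    (f : EuclideanSpace ℝ (Fin N) → ℝ) (hf : MemLp f ⊤ volume)
    (w₁ w₂ : EuclideanSpace ℝ (Fin N) → ℝ)
    (hw₁ : LevyDiffusion.IsDistributionalSolution σ μ φ f w₁)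
    (hw₁f : MemLp (fun x => w₁ x - f x) 1 volume)
    (hw₂ : LevyDiffusion.IsDistributionalSolution σ μ φ f w₂)
    (hw₂f : MemLp (fun x => w₂ x - f x) 1 volume) :
    w₁ =ᵐ[volume] w₂ := by
  obtain ⟨v₁, B₁, hv₁, hB₁, hwv₁⟩ :=
    LevyDiffusion.exists_measurable_bounded_of_memLp_top hw₁.memLp_top
  obtain ⟨v₂, B₂, hv₂, hB₂, hwv₂⟩ :=
    LevyDiffusion.exists_measurable_bounded_of_memLp_top hw₂.memLp_top
  have hB₁0 : 0 ≤ B₁ := (abs_nonneg _).trans (hB₁ 0)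
  have hB₂0 : 0 ≤ B₂ := (abs_nonneg _).trans (hB₂ 0)
  set B := B₁ + B₂ with hB
  have hv₁B : ∀ x, v₁ x ∈ Set.Icc (-B) B := fun x => by
    have := abs_le.1 (hB₁ x); constructor <;> linarith
  have hv₂B : ∀ x, v₂ x ∈ Set.Icc (-B) B := fun x => by
    have := abs_le.1 (hB₂ x); constructor <;> linarith
  obtain ⟨M, hM⟩ := isCompact_Icc.exists_bound_of_continuousOn
    (hφ_cont.continuousOn (s := Set.Icc (-B) B))
  have hφ₁ : Measurable fun x => φ (v₁ x) := hφ_cont.measurable.comp hv₁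
  have hφ₂ : Measurable fun x => φ (v₂ x) := hφ_cont.measurable.comp hv₂
  have hM₁ : ∀ x, |φ (v₁ x)| ≤ M := fun x => hM _ (hv₁B x)
  have hM₂ : ∀ x, |φ (v₂ x)| ≤ M := fun x => hM _ (hv₂B x)
  have hf₁ : Integrable fun x => w₁ x - f x := memLp_one_iff_integrable.1 hw₁f
  have hf₂ : Integrable fun x => w₂ x - f x := memLp_one_iff_integrable.1 hw₂f
  have hUi : Integrable fun x => v₁ x - v₂ x := by
    refine (hf₁.sub hf₂).congr ?_
    filter_upwards [hwv₁, hwv₂] with x h1 h2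
    simp [h1, h2]
  have hUm : Measurable fun x => v₁ x - v₂ x := hv₁.sub hv₂
  have hVm : Measurable fun x => φ (v₁ x) - φ (v₂ x) := hφ₁.sub hφ₂
  have hVb : ∀ x, |φ (v₁ x) - φ (v₂ x)| ≤ M + M := fun x =>
    (abs_sub _ _).trans (add_le_add (hM₁ x) (hM₂ x))
  have hpos : 0 ≤ ∫ x, (v₁ x - v₂ x) * (φ (v₁ x) - φ (v₂ x)) := by
    refine integral_nonneg fun x => ?_
    rcases le_total (v₁ x) (v₂ x) with h | h
    · exact mul_nonneg_of_nonpos_of_nonpos (sub_nonpos.2 h) (sub_nonpos.2 (hφ_mono h))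
    · exact mul_nonneg (sub_nonneg.2 h) (sub_nonneg.2 (hφ_mono h))
  -- By uniform continuity of `φ` on `[-B, B]` this set lies in `{δ ≤ |v₁ - v₂|}`, which has finite
  -- measure because `v₁ - v₂` is integrable.
  have hfin : ∀ θ > 0, volume {x | θ ≤ |φ (v₁ x) - φ (v₂ x)|} < ⊤ := by
    intro θ hθ
    have huc := isCompact_Icc.uniformContinuousOn_of_continuous
      (hφ_cont.continuousOn (s := Set.Icc (-B) B))
    obtain ⟨δ, hδ, h⟩ := Metric.uniformContinuousOn_iff.1 huc θ hθ
    refine lt_of_le_of_lt (measure_mono ?_) (hUi.measure_norm_ge_lt_top hδ)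
    intro x hx
    by_contra hlt
    have h1 : dist (v₁ x) (v₂ x) < δ := by simpa [Real.dist_eq] using hlt
    have h2 := h _ (hv₁B x) _ (hv₂B x) h1
    rw [Real.dist_eq] at h2
    exact absurd hx (by simpa using h2)
  -- The terms are grouped around `w - f`, whose integrability is assumed, so that `f` cancels
  -- between the two solutions. Splitting the integral also requires `𝔏[ψ]` to be integrable.
  have hweak : ∀ (w v : EuclideanSpace ℝ (Fin N) → ℝ),
      LevyDiffusion.IsDistributionalSolution σ μ φ f w → w =ᵐ[volume] v → Measurable v →
      (∀ x, |φ (v x)| ≤ M) → Integrable (fun x => w x - f x) →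
      ∀ ψ : EuclideanSpace ℝ (Fin N) → ℝ, ContDiff ℝ ∞ ψ → HasCompactSupport ψ →
      ∫ x, (w x - f x) * ψ x = ∫ x, φ (v x) * LevyDiffusion.diffusionOp σ μ ψ x := by
    intro w v hw hwv hv hMv hwf ψ hψ hc
    obtain ⟨D, hD⟩ := LevyDiffusion.exists_abs_le_of_hasCompactSupport hψ.continuous hc
    have h := hw.weak_eq ψ hψ hc
    have i1 := LevyDiffusion.Integrable.mul_of_abs_le hwf hψ.continuous.measurable hD
    have i2 : Integrable fun x => LevyDiffusion.diffusionOp σ μ ψ x * φ (v x) :=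
      LevyDiffusion.Integrable.mul_of_abs_le
        (LevyDiffusion.integrable_diffusionOp (σ := σ) hμ hψ hc) (hφ_cont.measurable.comp hv) hMv
    have e : ∫ x, (w x * ψ x - φ (w x) * LevyDiffusion.diffusionOp σ μ ψ x - f x * ψ x)
        = ∫ x, ((w x - f x) * ψ x - LevyDiffusion.diffusionOp σ μ ψ x * φ (v x)) := by
      refine integral_congr_ae ?_
      filter_upwards [hwv] with x hx
      rw [← hx]; ring
    rw [e, integral_sub i1 i2, sub_eq_zero] at h
    rw [h]
    simp_rw [mul_comm]
  have hUV : ∀ ψ : EuclideanSpace ℝ (Fin N) → ℝ, ContDiff ℝ ∞ ψ → HasCompactSupport ψ →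
      ∫ x, (v₁ x - v₂ x) * ψ x
        = ∫ x, (φ (v₁ x) - φ (v₂ x)) * LevyDiffusion.diffusionOp σ μ ψ x := by
    intro ψ hψ hc
    obtain ⟨D, hD⟩ := LevyDiffusion.exists_abs_le_of_hasCompactSupport hψ.continuous hc
    have hLi := LevyDiffusion.integrable_diffusionOp (σ := σ) hμ hψ hc
    have j₁ : Integrable fun x => φ (v₁ x) * LevyDiffusion.diffusionOp σ μ ψ x :=
      hLi.bdd_mul hφ₁.aestronglyMeasurable (Filter.Eventually.of_forall hM₁)
    have j₂ : Integrable fun x => φ (v₂ x) * LevyDiffusion.diffusionOp σ μ ψ x :=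
      hLi.bdd_mul hφ₂.aestronglyMeasurable (Filter.Eventually.of_forall hM₂)
    simp_rw [sub_mul (φ _)]
    rw [integral_sub j₁ j₂, ← hweak w₁ v₁ hw₁ hwv₁ hv₁ hM₁ hf₁ ψ hψ hc,
      ← hweak w₂ v₂ hw₂ hwv₂ hv₂ hM₂ hf₂ ψ hψ hc,
      ← integral_sub (LevyDiffusion.Integrable.mul_of_abs_le hf₁ hψ.continuous.measurable hD)
        (LevyDiffusion.Integrable.mul_of_abs_le hf₂ hψ.continuous.measurable hD)]
    refine integral_congr_ae ?_
    filter_upwards [hwv₁, hwv₂] with x h1 h2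
    rw [← h1, ← h2]; ring
  have hzero : ∀ᵐ x, v₁ x - v₂ x = 0 := by
    refine ae_eq_zero_of_integral_contDiff_smul_eq_zero hUi.locallyIntegrable fun g hg hgc => ?_
    simp_rw [smul_eq_mul, mul_comm (g _)]
    exact LevyDiffusion.integral_mul_eq_zero hμ hUm hUi hVm hVb hfin hpos hUV hg hgc
  filter_upwards [hwv₁, hwv₂, hzero] with x h1 h2 h3
  rw [h1, h2]
  linarith
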